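/- Let $(M,\mathcal C)$ be a $(2n+1)$-dimensional contact manifold: $\mathcal C$ is a hyperplane distribution which is locally the kernel of a smooth nowhere zero 1-form $\theta$ with $d\theta|_{\mathcal C}$ nondegenerate. Put $M^{(0)}=M$, and let $M^{(k+1)}$ be the manifold of Lagrangian planes of $M^{(k)}$, with projection $\pi_{k+1,k}:M^{(k+1)}\to M^{(k)}$; a point $m^{k+1}\in M^{(k+1)}$ over $m^k$ is regarded as a plane $L_{m^{k+1}}\subset T_{m^k}M^{(k)}$. Here a Lagrangian plane of $M^{(k)}$ is an $n$-dimensional subspace of a tangent space $T_{m^k}M^{(k)}$ which, if $k\ge 1$, is mapped injectively by $d\pi_{k,k-1}$, and on which, in the coordinates $(x^i,p_I)_{|I|\le k+1}$ ($p_\emptyset=z$) of $M^{(k)}$ induced by contact coordinates $(x^i,z,p_i)$ of $M$ (in which $\mathcal C=\ker(dz-p_i\,dx^i)$), the forms $\theta_I=dp_I-p_{I,i}\,dx^i$ and $d\theta_I$ vanish for all $|I|\le k$. In the induced coordinates of $M^{(k+1)}$ this plane is $L_{m^{k+1}}=\big\langle \partial_{x^i}+\sum_{|I|\le k+1}p_{I,i}\,\partial_{p_I}\;:\;1\le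 i\le n\big\rangle$. Let $\mathcal E\subset M^{(1)}$ be a scalar second order PDE, i.e. a smooth hypersurface, given near each of its points by a regular equation $F(x^i,z,p_i,p_{ij})=0$ with $F$ smooth and $dF\neq0$ along $\mathcal E$. Its conformal metric $g_{\mathcal E}$ at $m^1\in\mathcal E$ is the class, up to nonzero factors, of the symmetric bivector $g_{dF}$ on $L_{m^1}$ whose matrix in the basis $\partial_{x^i}+p_i\partial_z+p_{ij}\partial_{p_j}$ is $g^{ij}=\frac{1}{2-\delta_{ij}}\frac{\partial F}{\partial p_{ij}}(m^1)$. The prolongations of $\mathcal E$ are $\mathcal E^{(0)}=\mathcal E$ and $$\mathcal E^{(k+1)}=\{m^{k+2}\in M^{(k+2)} : m^{k+1}:=\pi_{k+2,k+1}(m^{k+2})\in\mathcal E^{(k)},\ L_{m^{k+2}}\subset T_{m^{k+1}}\mathcal E^{(k)}\}\subset M^{(k+2)} .$$ Theorem. If $g_{\mathcal E}$ vanishes nowhere on $\mathcal E$, i.e. $(g_{dF})_{m^1}\neq0$ for every $m^1\in\mathcal E$, then $\mathcal E$ is formally integrable: for every $k\ge0$ the prolongation $\mathcal E^{(k)}$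 is a smooth submanifold of $M^{(k+1)}$, and the projection $\pi_{k+2,k+1}|_{\mathcal E^{(k+1)}}:\mathcal E^{(k+1)}\to\mathcal E^{(k)}$ is a (surjective) smooth fibre bundle. -/

import Mathlib

open Set Filter Topology
open scoped Manifold ContDiff

noncomputable section

namespace ContactPDE

/-! ## Jet coordinates -/

/-- Multi-indices `I = (i₁ ⋯ i_ℓ)` in `{1, …, n}`, up to reordering, of length `ℓ ≤ k`. -/
abbrev MultiIndex (n k : ℕ) : Type := {I : Multiset (Fin n) // I.card ≤ k}

instance (n k : ℕ) : Finite (MultiIndex n k) := by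
  refine Finite.of_injective
    (fun I : MultiIndex n k =>
      (⟨⟨I.1.card, Nat.lt_succ_of_le I.2⟩, ⟨I.1, rfl⟩⟩ : Σ l : Fin (k + 1), Sym (Fin n) l)) ?_
  intro I J h
  have h2 := congrArg (fun s : Σ l : Fin (k + 1), Sym (Fin n) l => (s.2 : Multiset (Fin n))) h
  exact Subtype.ext h2

instance (n k : ℕ) : Fintype (MultiIndex n k) := Fintype.ofFinite _

namespace MultiIndex

/-- The empty multi-index; the coordinate `p_∅` is `z`. -/
def empty (n k : ℕ) : MultiIndex n k := ⟨0, by simp⟩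

/-- The multi-index `I, i`. -/
def snoc {n k : ℕ} (I : MultiIndex n k) (i : Fin n) : MultiIndex n (k + 1) :=
  ⟨i ::ₘ I.1, by simpa using I.2⟩

/-- `I` itself, seen among the multi-indices of length at most `k + 1`. -/
def incl {n k : ℕ} (I : MultiIndex n k) : MultiIndex n (k + 1) := ⟨I.1, I.2.trans (Nat.le_succ k)⟩

/-- The multi-index `(i j)`. -/
def pair {n : ℕ} (i j : Fin n) : MultiIndex n 2 := ⟨{i, j}, by simp⟩

end MultiIndex

/-- The coordinate space with coordinates `(xⁱ, p_I)`, `|I| ≤ k`, where `p_∅ = z`. It is the space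
of `k`-jets of functions of `n` variables. -/
abbrev Jet (n k : ℕ) : Type := (Fin n → ℝ) × (MultiIndex n k → ℝ)

/-- Forgetting the coordinates `p_I` with `|I| = k + 1`. -/
def jetProj (n k : ℕ) : Jet n (k + 1) →ₗ[ℝ] Jet n k where
  toFun q := (q.1, fun I => q.2 I.incl)
  map_add' _ _ := rfl
  map_smul' _ _ := rfl

/-- The vector `∂_{xⁱ} + ∑_{|I| ≤ k} p_{I,i} ∂_{p_I}`. -/
def totalVector {n k : ℕ} (q : Jet n (k + 1)) (i : Fin n) : Jet n k :=
  (Pi.single i 1, fun I => q.2 (I.snoc i))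

/-- The plane spanned by the vectors `∂_{xⁱ} + ∑_{|I| ≤ k} p_{I,i} ∂_{p_I}`, `i = 1, …, n`. -/
def jetPlane {n k : ℕ} (q : Jet n (k + 1)) : Submodule ℝ (Jet n k) :=
  Submodule.span ℝ (range (totalVector q))

/-- The value at `q` on the vector `v` of the form `θ_I = dp_I - p_{I,i} dxⁱ`, `|I| ≤ k`. -/
def theta {n k : ℕ} (I : MultiIndex n k) (q v : Jet n (k + 1)) : ℝ :=
  v.2 I.incl - ∑ i, q.2 (I.snoc i) * v.1 i

/-- The value on `(v, w)` of the form `dθ_I = - dp_{I,i} ∧ dxⁱ`, `|I| ≤ k`. -/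
def dtheta {n k : ℕ} (I : MultiIndex n k) (v w : Jet n (k + 1)) : ℝ :=
  -∑ i, (v.2 (I.snoc i) * w.1 i - w.2 (I.snoc i) * v.1 i)

/-! ## Contact manifolds -/

section Contact

variable (n : ℕ) (M : Type*) [TopologicalSpace M]
  [ChartedSpace (EuclideanSpace ℝ (Fin (2 * n + 1))) M]

/-- A contact structure on a `(2n+1)`-dimensional manifold: a distribution of hyperplanes that is
locally the kernel of a smooth nowhere zero 1-form `α` for which `dα` is nondegenerate on `ker α`
(complete non-integrability). The form is written in the manifold chart around `m₀`. -/
structure ContactStructure where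
  /-- The contact distribution. -/
  dist : ∀ m : M, Submodule ℝ (TangentSpace (𝓡 (2 * n + 1)) m)
  locally_contact : ∀ m₀ : M,
    ∃ (U : Set (EuclideanSpace ℝ (Fin (2 * n + 1))))
      (α : EuclideanSpace ℝ (Fin (2 * n + 1)) → (EuclideanSpace ℝ (Fin (2 * n + 1)) →L[ℝ] ℝ)),
      IsOpen U ∧ extChartAt (𝓡 (2 * n + 1)) m₀ m₀ ∈ U ∧
      U ⊆ (extChartAt (𝓡 (2 * n + 1)) m₀).target ∧ ContDiffOn ℝ ∞ α U ∧
      (∀ y ∈ U, α y ≠ 0 ∧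
        ∀ v, α y v = 0 → (∀ w, α y w = 0 → fderiv ℝ α y v w - fderiv ℝ α y w v = 0) → v = 0) ∧
      ∀ m ∈ (extChartAt (𝓡 (2 * n + 1)) m₀).source, extChartAt (𝓡 (2 * n + 1)) m₀ m ∈ U →
        ∀ v : TangentSpace (𝓡 (2 * n + 1)) m,
          v ∈ dist m ↔
            α (extChartAt (𝓡 (2 * n + 1)) m₀ m)
              (mfderiv (𝓡 (2 * n + 1)) 𝓘(ℝ, EuclideanSpace ℝ (Fin (2 * n + 1)))
                (extChartAt (𝓡 (2 * n + 1)) m₀) m v) = 0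

variable {n M}

/-- A contact (Darboux) chart `(xⁱ, z, p_i)` of `M`: a local diffeomorphism to `Jet n 1` that takes
the contact distribution to the kernel of `dz - p_i dxⁱ`. -/
structure ContactChart (C : ContactStructure n M) where
  /-- The underlying local homeomorphism. -/
  toHomeo : OpenPartialHomeomorph M (Jet n 1)
  smooth : ContMDiffOn (𝓡 (2 * n + 1)) 𝓘(ℝ, Jet n 1) ∞ toHomeo toHomeo.source
  smooth_symm : ContMDiffOn 𝓘(ℝ, Jet n 1) (𝓡 (2 * n + 1)) ∞ toHomeo.symm toHomeo.target
  contact : ∀ m ∈ toHomeo.source, ∀ v : TangentSpace (𝓡 (2 * n + 1)) m,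
    v ∈ C.dist m ↔
      theta (MultiIndex.empty n 0) (toHomeo m)
        (mfderiv (𝓡 (2 * n + 1)) 𝓘(ℝ, Jet n 1) toHomeo m v) = 0

end Contact

/-! ## Spaces with a smooth structure given by an indexed family of charts -/

universe u

/-- A space together with local coordinates `coord a` on `source a`, for each index `a`, with
values in `V`. The smooth structures of all the spaces below are given in this way. -/
structure ChartSystem (A : Type u) (V : Type) where
  /-- The points. -/
  carrier : Type u
  /-- The domain of the chart with index `a`. -/
  source : A → Set carrier
  /-- The coordinates of a point in the chart with index `a`. -/
  coord : A → carrier → V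

namespace ChartSystem

variable {A : Type u} {V : Type}

/-- The coordinate image of a subset in the chart `a`. -/
def image (X : ChartSystem A V) (a : A) (S : Set X.carrier) : Set V :=
  X.coord a '' (S ∩ X.source a)

variable [NormedAddCommGroup V] [NormedSpace ℝ V]

open Classical in
/-- The change of coordinates from the chart `a` to the chart `b`. -/
def trans (X : ChartSystem A V) (a b : A) (q : V) : V :=
  if h : ∃ x ∈ X.source a ∩ X.source b, X.coord a x = q then X.coord b h.choose else 0

/-- The tangent space at `x`: a tangent vector is given by its components in all the charts around
`x`, which are related by the derivatives of the changes of coordinates. (The component at the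
index of a chart that does not contain `x` carries no information and is set to zero.) -/
def tangentSpace (X : ChartSystem A V) (x : X.carrier) : Submodule ℝ (A → V) where
  carrier := {v | (∀ a, x ∉ X.source a → v a = 0) ∧
    ∀ a b, x ∈ X.source a → x ∈ X.source b →
      v b = fderiv ℝ (X.trans a b) (X.coord a x) (v a)}
  zero_mem' := by simp
  add_mem' := by
    rintro v w ⟨hv, hv2⟩ ⟨hw, hw2⟩
    refine ⟨fun a ha => by simp [hv a ha, hw a ha], fun a b ha hb => ?_⟩
    simp only [Pi.add_apply, map_add]
    rw [hv2 a b ha hb, hw2 a b ha hb]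
  smul_mem' := by
    rintro c v ⟨hv, hv2⟩
    refine ⟨fun a ha => by simp [hv a ha], fun a b ha hb => ?_⟩
    simp only [Pi.smul_apply, map_smul]
    rw [hv2 a b ha hb]

/-- The vectors tangent at `x` to a subset `S`: the velocities of smooth curves in `S`.
For a submanifold this is its tangent space. -/
def tangentTo (X : ChartSystem A V) (S : Set X.carrier) (x : X.carrier) : Set (A → V) :=
  {v | v ∈ X.tangentSpace x ∧ ∀ a, x ∈ X.source a →
    ∃ γ : ℝ → V, ContDiff ℝ ∞ γ ∧ γ 0 = X.coord a x ∧ HasDerivAt γ (v a) 0 ∧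
      ∀ᶠ t in 𝓝 0, γ t ∈ X.image a S}

end ChartSystem

/-- `S` is an embedded smooth submanifold, of dimension `d`, of (an open subset of) `V`: around
each of its points it is a linear slice in suitable smooth coordinates. -/
def IsSubmanifoldOfDim {V : Type} [NormedAddCommGroup V] [NormedSpace ℝ V] (S : Set V) (d : ℕ) :
    Prop :=
  ∀ x ∈ S, ∃ (φ : OpenPartialHomeomorph V V) (W : Submodule ℝ V),
    x ∈ φ.source ∧ ContDiffOn ℝ ∞ φ φ.source ∧ ContDiffOn ℝ ∞ φ.symm φ.target ∧
    Module.finrank ℝ W = d ∧ ∀ y ∈ φ.source, y ∈ S ↔ φ y ∈ W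

/-- A smooth submanifold of a space with charts. -/
def ChartSystem.IsSubmanifold {A : Type u} {V : Type} [NormedAddCommGroup V] [NormedSpace ℝ V]
    (X : ChartSystem A V) (S : Set X.carrier) : Prop :=
  ∃ d : ℕ, ∀ a : A, IsSubmanifoldOfDim (X.image a S) d

/-! ## Lagrangian planes and prolongations -/

section Prolongation

variable {A : Type u} {n k : ℕ}

/-- `L` is a Lagrangian plane of `X` (which plays the role of `M⁽ᵏ⁾`) at `x`: an `n`-dimensional
subspace of the tangent space on which the forms `θ_I` and `dθ_I`, `|I| ≤ k`, vanish, and which for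
`k ≥ 1` is horizontal, that is, projects injectively under `X = M⁽ᵏ⁾ → M⁽ᵏ⁻¹⁾`. -/
structure IsLagrangianPlane (X : ChartSystem A (Jet n (k + 1))) (x : X.carrier)
    (L : Submodule ℝ (A → Jet n (k + 1))) : Prop where
  le_tangentSpace : L ≤ X.tangentSpace x
  finrank_eq : Module.finrank ℝ L = n
  finiteDimensional : FiniteDimensional ℝ L
  theta_eq_zero : ∀ v ∈ L, ∀ a, x ∈ X.source a → ∀ I : MultiIndex n k,
    theta I (X.coord a x) (v a) = 0
  dtheta_eq_zero : ∀ v ∈ L, ∀ w ∈ L, ∀ a, x ∈ X.source a → ∀ I : MultiIndex n k,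
    dtheta I (v a) (w a) = 0
  horizontal : 1 ≤ k → ∀ v ∈ L, ∀ a, x ∈ X.source a → jetProj n k (v a) = 0 → v = 0

/-- `q` gives the coordinates, in the chart `a`, of the plane `L` at the point `x`: the coordinates
`(xⁱ, p_I)`, `|I| ≤ k + 1`, are those of `x`, and `L` is spanned by the vectors
`∂_{xⁱ} + ∑ p_{I,i} ∂_{p_I}`. -/
def IsPlaneCoord (X : ChartSystem A (Jet n (k + 1))) (a : A) (x : X.carrier)
    (L : Submodule ℝ (A → Jet n (k + 1))) (q : Jet n (k + 2)) : Prop :=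
  x ∈ X.source a ∧ jetProj n (k + 1) q = X.coord a x ∧
    L.map (LinearMap.proj (R := ℝ) (φ := fun _ : A => Jet n (k + 1)) a) = jetPlane q

/-- The prolongation: the space of Lagrangian planes, with the induced charts. -/
def prolong (X : ChartSystem A (Jet n (k + 1))) : ChartSystem A (Jet n (k + 2)) where
  carrier := {y : X.carrier × Submodule ℝ (A → Jet n (k + 1)) // IsLagrangianPlane X y.1 y.2}
  source a := {y | ∃ q, IsPlaneCoord X a y.1.1 y.1.2 q}
  coord a y := Classical.epsilon fun q => IsPlaneCoord X a y.1.1 y.1.2 q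

/-- The point at which a Lagrangian plane sits. -/
def basePoint {X : ChartSystem A (Jet n (k + 1))} (y : (prolong X).carrier) : X.carrier := y.1.1

/-- The Lagrangian plane `L_y` given by a point `y`. -/
def plane {X : ChartSystem A (Jet n (k + 1))} (y : (prolong X).carrier) :
    Submodule ℝ (A → Jet n (k + 1)) := y.1.2

/-- The first prolongation of a submanifold `S` (of dimension at least `n`): the Lagrangian planes
at points of `S` that are tangent to `S`. -/
def prolongSet {X : ChartSystem A (Jet n (k + 1))} (S : Set X.carrier) :
    Set (prolong X).carrier :=
  {y | basePoint y ∈ S ∧ (plane y : Set (A → Jet n (k + 1))) ⊆ X.tangentTo S (basePoint y)}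

/-- The projection of `S' ⊆ prolong X` to `S ⊆ X` is a smooth fibre bundle: it is onto, and around
each point of `S` it is diffeomorphic over the base to a product with a fixed nonempty smooth
manifold `F`. Here `U` is a neighbourhood of `b`, given in the chart `a`; the part of `S'` over
`U` lies in the domain of the induced chart, and in coordinates `q' ↦ (jetProj q', Ψ q')` is a
diffeomorphism from it onto `(S ∩ U) × F`, with inverse `Φ`. -/
def IsSmoothFibreBundle {X : ChartSystem A (Jet n (k + 1))} (S : Set X.carrier)
    (S' : Set (prolong X).carrier) : Prop :=
  MapsTo basePoint S' S ∧ SurjOn basePoint S' S ∧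
  ∃ (d : ℕ) (F : Type) (_ : TopologicalSpace F) (_ : ChartedSpace (EuclideanSpace ℝ (Fin d)) F),
    IsManifold (𝓡 d) ∞ F ∧ Nonempty F ∧
    ∀ a : A, ∀ b ∈ S, b ∈ X.source a →
      ∃ (U : Set (Jet n (k + 1))) (Ψ : Jet n (k + 2) → F)
        (Φ : Jet n (k + 1) × F → Jet n (k + 2)),
        IsOpen U ∧ X.coord a b ∈ U ∧
        (∀ y ∈ S', basePoint y ∈ X.source a → X.coord a (basePoint y) ∈ U →
          y ∈ (prolong X).source a) ∧
        ContMDiffOn 𝓘(ℝ, Jet n (k + 2)) (𝓡 d) ∞ Ψ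
          ((prolong X).image a S' ∩ jetProj n (k + 1) ⁻¹' U) ∧
        ContMDiffOn (𝓘(ℝ, Jet n (k + 1)).prod (𝓡 d)) 𝓘(ℝ, Jet n (k + 2)) ∞ Φ
          ((X.image a S ∩ U) ×ˢ univ) ∧
        (∀ q ∈ X.image a S ∩ U, ∀ f : F,
          Φ (q, f) ∈ (prolong X).image a S' ∧ jetProj n (k + 1) (Φ (q, f)) = q ∧
            Ψ (Φ (q, f)) = f) ∧
        ∀ q' ∈ (prolong X).image a S', jetProj n (k + 1) q' ∈ U →
          jetProj n (k + 1) q' ∈ X.image a S ∧ Φ (jetProj n (k + 1) q', Ψ q') = q'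

end Prolongation

/-! ## The prolongations of a contact manifold and second order equations -/

section Equations

variable {n : ℕ} {M : Type u} [TopologicalSpace M]
  [ChartedSpace (EuclideanSpace ℝ (Fin (2 * n + 1))) M]

/-- `M⁽ᵏ⁾`: `M⁽⁰⁾ = M` with its contact charts, and `M⁽ᵏ⁺¹⁾` is the space of Lagrangian planes
of `M⁽ᵏ⁾`. -/
def prolongation (C : ContactStructure n M) :
    (k : ℕ) → ChartSystem (ContactChart C) (Jet n (k + 1))
  | 0 => { carrier := M
           source := fun a => a.toHomeo.source
           coord := fun a => a.toHomeo }
  | k + 1 => prolong (prolongation C k)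

/-- A regular local equation of `E ⊆ M⁽¹⁾` near `e`: in the coordinates `(xⁱ, z, p_i, p_ij)` of a
contact chart around `e`, on an open set `U` around `e`, the set `E` is `{F = 0}` with `F` smooth
and `dF ≠ 0` along `E`. -/
structure LocalEquation {C : ContactStructure n M} (E : Set (prolongation C 1).carrier)
    (e : (prolongation C 1).carrier) where
  /-- The contact chart. -/
  chart : ContactChart C
  /-- The domain of the equation. -/
  U : Set (Jet n 2)
  /-- The function defining the equation. -/
  F : Jet n 2 → ℝ
  mem_source : e ∈ (prolongation C 1).source chart
  coord_mem : (prolongation C 1).coord chart e ∈ U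
  isOpen : IsOpen U
  smooth : ContDiffOn ℝ ∞ F U
  mem_iff : ∀ x ∈ (prolongation C 1).source chart, (prolongation C 1).coord chart x ∈ U →
    (x ∈ E ↔ F ((prolongation C 1).coord chart x) = 0)
  regular : ∀ q ∈ (prolongation C 1).image chart E ∩ U, fderiv ℝ F q ≠ 0

/-- A scalar second order PDE: a smooth hypersurface `E` of `M⁽¹⁾`. -/
def IsSecondOrderPDE {C : ContactStructure n M} (E : Set (prolongation C 1).carrier) : Prop :=
  ∀ e ∈ E, Nonempty (LocalEquation E e)

/-- The matrix `g^{ij} = (2 - δ_ij)⁻¹ ∂F/∂p_ij` of the contravariant metric `g_{dF}`, a symmetric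
bivector on the Lagrangian plane with coordinates `q`, in the basis of this plane formed by the
vectors `∂_{xⁱ} + p_i ∂_z + p_ij ∂_{p_j}`. -/
def metricMatrix (F : Jet n 2 → ℝ) (q : Jet n 2) : Matrix (Fin n) (Fin n) ℝ :=
  Matrix.of fun i j =>
    (2 - if i = j then 1 else 0)⁻¹ * fderiv ℝ F q (0, Pi.single (MultiIndex.pair i j) 1)

/-- The conformal metric of `E`, the class of `g_{dF}` up to nonzero factors, does not vanish
at `e`. -/
def ConformalMetricNeZero {C : ContactStructure n M} (E : Set (prolongation C 1).carrier)
    (e : (prolongation C 1).carrier) : Prop :=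
  ∃ Q : LocalEquation E e, metricMatrix Q.F ((prolongation C 1).coord Q.chart e) ≠ 0

/-- The `k`-th prolongation `E⁽ᵏ⁾ ⊆ M⁽ᵏ⁺¹⁾` of `E ⊆ M⁽¹⁾`. -/
def prolongedEquation {C : ContactStructure n M} (E : Set (prolongation C 1).carrier) :
    (k : ℕ) → Set (prolongation C (k + 1)).carrier
  | 0 => E
  | k + 1 => prolongSet (X := prolongation C (k + 1)) (prolongedEquation E k)

/-- Formal integrability: all the prolongations `E⁽ᵏ⁾` are smooth submanifolds of `M⁽ᵏ⁺¹⁾`, and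
all the projections `E⁽ᵏ⁺¹⁾ → E⁽ᵏ⁾` are smooth fibre bundles. -/
def FormallyIntegrable {C : ContactStructure n M} (E : Set (prolongation C 1).carrier) : Prop :=
  (∀ k, (prolongation C (k + 1)).IsSubmanifold (prolongedEquation E k)) ∧
  ∀ k, IsSmoothFibreBundle (X := prolongation C (k + 1)) (prolongedEquation E k)
    (prolongedEquation E (k + 1))

end Equations

end ContactPDE

end

open Set Filter Topology
open scoped Manifold ContDiff

noncomputable section

namespace ContactPDE

universe u

/-! In a contact chart `E` is `F = 0`, and `E⁽ᵏ⁺¹⁾` is cut out over `E⁽ᵏ⁾` by the total derivatives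
`D_J F = 0`, `|J| = k + 1`. These are affine in the new coordinates `p_K`, `|K| = k + 3`, with
linear part `z ↦ (∑_I ∂F/∂p_I · z_{J+I})_J`. The transpose of this linear part is multiplication by
the quadratic form `σ = ∑_I ∂F/∂p_I ξ^I`, from polynomials of degree `k + 1` to those of degree `k +
3`. A nonvanishing conformal metric means `σ ≠ 0`; a polynomial ring over a field is a domain, so
the transpose is injective and the linear part is onto (`symbolMap_surjective`). A scalar equation
therefore meets no compatibility conditions: the fibres of `E⁽ᵏ⁺¹⁾ → E⁽ᵏ⁾` are affine spaces of
constant dimension, and the fibration is smoothly trivial near each point (`AffineTriv`).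

Two more things are needed. The induced charts must form a smooth structure. Coordinate changes
preserve the kernel of the `θ_I`, hence also the relations `dθ_I = 0` inside it
(`dtheta_map_eq_zero`), and this property passes to the prolongation (`IsContactSystem.prolong`).
Moreover, tangency to `E⁽ᵏ⁾`, which is defined by velocities of curves, must follow from the
equations (`IsEquation.mem_jetImage_succ_iff`). For `k = 0` this is the straightening of a
hypersurface; afterwards curves in `E⁽ᵏ⁾` are lifted to `E⁽ᵏ⁺¹⁾` with a prescribed velocity
(`AffineTriv.hasVelocity_lift`). -/

/-! ## Velocities of curves -/

section Velocity

variable {V W : Type} [NormedAddCommGroup V] [NormedSpace ℝ V]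
  [NormedAddCommGroup W] [NormedSpace ℝ W]

/-- `v` is the velocity at `q` of a smooth curve in `S`. -/
def HasVelocity (S : Set V) (q v : V) : Prop :=
  ∃ γ : ℝ → V, ContDiff ℝ ∞ γ ∧ γ 0 = q ∧ HasDerivAt γ v 0 ∧ ∀ᶠ t in 𝓝 0, γ t ∈ S

/-- Precomposing a curve with such a `ρ` keeps its position and velocity at time `0` and turns
conditions valid only near `0` into conditions valid for all times. -/
theorem exists_smooth_truncation {ε : ℝ} (hε : 0 < ε) :
    ∃ ρ : ℝ → ℝ, ContDiff ℝ ∞ ρ ∧ ρ 0 = 0 ∧ HasDerivAt ρ 1 0 ∧ ∀ t, |ρ t| < ε := by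
  refine ⟨fun t => ε / 2 * Real.sin (t / (ε / 2)), by fun_prop, by simp, ?_, fun t => ?_⟩
  · have h1 : HasDerivAt (fun t : ℝ => t / (ε / 2)) (1 / (ε / 2)) 0 :=
      (hasDerivAt_id (0 : ℝ)).div_const _
    have h2 := (h1.sin).const_mul (ε / 2)
    have h3 : ε / 2 * (Real.cos (0 / (ε / 2)) * (1 / (ε / 2))) = 1 := by
      rw [zero_div, Real.cos_zero]
      field_simp
    rwa [h3] at h2
  · rw [abs_mul, abs_of_pos (by positivity : 0 < ε / 2)]
    have := Real.abs_sin_le_one (t / (ε / 2))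
    nlinarith

theorem HasVelocity.exists_mem {S O : Set V} {q v : V} (h : HasVelocity S q v) (hO : O ∈ 𝓝 q) :
    ∃ γ : ℝ → V, ContDiff ℝ ∞ γ ∧ γ 0 = q ∧ HasDerivAt γ v 0 ∧ ∀ t, γ t ∈ S ∩ O := by
  obtain ⟨γ, hγ, h0, hd, hS⟩ := h
  have hO' : ∀ᶠ t in 𝓝 (0 : ℝ), γ t ∈ S ∩ O := by
    refine hS.and ?_
    exact hγ.continuous.continuousAt.eventually_mem (by rwa [h0])
  obtain ⟨ε, hε, hball⟩ := Metric.eventually_nhds_iff.1 hO'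
  obtain ⟨ρ, hρ, hρ0, hρd, hρb⟩ := exists_smooth_truncation hε
  refine ⟨γ ∘ ρ, hγ.comp hρ, by simp [hρ0, h0], ?_, fun t => ?_⟩
  · have := HasDerivAt.scomp (0 : ℝ) (h := ρ) (g₁ := γ) (by rw [hρ0]; exact hd) hρd
    simpa using this
  · exact hball (by simpa [Real.dist_eq] using hρb t)

/-- Since `f` is smooth only on `O`, the curve is first reparametrized to stay in `O` for all times,
so that its image is a globally smooth curve. -/
theorem HasVelocity.map {S O : Set V} {S' : Set W} {f : V → W} {q v : V}
    (h : HasVelocity S q v) (hO : IsOpen O) (hq : q ∈ O) (hf : ContDiffOn ℝ ∞ f O)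
    (hS : ∀ p ∈ S ∩ O, f p ∈ S') : HasVelocity S' (f q) (fderiv ℝ f q v) := by
  obtain ⟨γ, hγ, h0, hd, hm⟩ := h.exists_mem (hO.mem_nhds hq)
  refine ⟨f ∘ γ, ?_, by simp [h0], ?_, Eventually.of_forall fun t => hS _ (hm t)⟩
  · exact contDiff_iff_contDiffAt.2 fun t =>
      (hf.contDiffAt (hO.mem_nhds (hm t).2)).comp t hγ.contDiffAt
  · have h1 : HasFDerivAt f (fderiv ℝ f q) (γ 0) := by
      rw [h0]
      exact ((hf.contDiffAt (hO.mem_nhds hq)).differentiableAt (by simp)).hasFDerivAt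
    exact h1.comp_hasDerivAt (0 : ℝ) hd

/-- A function that vanishes on `S` near `q` has derivative zero along the velocities of `S`. -/
theorem HasVelocity.fderiv_eq_zero {S O : Set V} {q v : V} {f : V → W} (h : HasVelocity S q v)
    (hO : O ∈ 𝓝 q) (hf : DifferentiableAt ℝ f q) (h0 : ∀ p ∈ S ∩ O, f p = 0) :
    fderiv ℝ f q v = 0 := by
  obtain ⟨γ, h1, h2, h3, h4⟩ := h.exists_mem hO
  have hf' : HasFDerivAt f (fderiv ℝ f q) (γ 0) := by rw [h2]; exact hf.hasFDerivAt
  have h5 := hf'.comp_hasDerivAt (0 : ℝ) h3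
  have h6 : f ∘ γ = fun _ => 0 := funext fun t => h0 _ (h4 t)
  rw [h6] at h5
  exact h5.unique (hasDerivAt_const _ _)

end Velocity

/-! ## Chart systems with smooth changes of coordinates -/

namespace ChartSystem

variable {A : Type u} {V : Type} {X : ChartSystem A V}

theorem coord_mem_image {a : A} {x : X.carrier} {S : Set X.carrier} (ha : x ∈ X.source a)
    (hx : x ∈ S) : X.coord a x ∈ X.image a S := ⟨x, ⟨hx, ha⟩, rfl⟩

variable [NormedAddCommGroup V]

/-- Injectivity of the chart makes the preimage chosen in `trans` irrelevant. -/
theorem trans_coord {a b : A} (h : InjOn (X.coord a) (X.source a)) {x : X.carrier}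
    (ha : x ∈ X.source a) (hb : x ∈ X.source b) : X.trans a b (X.coord a x) = X.coord b x := by
  have hex : ∃ y ∈ X.source a ∩ X.source b, X.coord a y = X.coord a x := ⟨x, ⟨ha, hb⟩, rfl⟩
  rw [trans, dif_pos hex, h hex.choose_spec.1.1 ha hex.choose_spec.2]

variable [NormedSpace ℝ V]

/-- The charts are injective, with open overlaps and smooth changes of coordinates. -/
structure IsSmooth (X : ChartSystem A V) : Prop where
  injOn : ∀ a, InjOn (X.coord a) (X.source a)
  isOpen_image : ∀ a b, IsOpen (X.image a (X.source b))
  contDiffOn_trans : ∀ a b, ContDiffOn ℝ ∞ (X.trans a b) (X.image a (X.source b))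

theorem IsSmooth.coord_mem_image_iff (h : X.IsSmooth) {a : A} {x : X.carrier} {S : Set X.carrier}
    (ha : x ∈ X.source a) : X.coord a x ∈ X.image a S ↔ x ∈ S := by
  refine ⟨?_, coord_mem_image ha⟩
  rintro ⟨y, ⟨hy, hya⟩, hxy⟩
  rwa [← h.injOn a hya ha hxy]

theorem IsSmooth.trans_coord (h : X.IsSmooth) {a b : A} {x : X.carrier} (ha : x ∈ X.source a)
    (hb : x ∈ X.source b) : X.trans a b (X.coord a x) = X.coord b x :=
  ChartSystem.trans_coord (h.injOn a) ha hb

theorem IsSmooth.differentiableAt_trans (h : X.IsSmooth) {a b : A} {x : X.carrier}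
    (ha : x ∈ X.source a) (hb : x ∈ X.source b) :
    DifferentiableAt ℝ (X.trans a b) (X.coord a x) :=
  ((h.contDiffOn_trans a b).contDiffAt ((h.isOpen_image a b).mem_nhds
    (coord_mem_image ha hb))).differentiableAt (by simp)

theorem IsSmooth.fderiv_trans_self (h : X.IsSmooth) {a : A} {x : X.carrier}
    (ha : x ∈ X.source a) (v : V) : fderiv ℝ (X.trans a a) (X.coord a x) v = v := by
  have h1 : X.trans a a =ᶠ[𝓝 (X.coord a x)] id := by
    filter_upwards [(h.isOpen_image a a).mem_nhds (coord_mem_image ha ha)]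
    rintro _ ⟨y, ⟨hy, -⟩, rfl⟩
    exact h.trans_coord hy hy
  rw [h1.fderiv_eq]
  simp

theorem IsSmooth.fderiv_trans_trans (h : X.IsSmooth) {a b c : A} {x : X.carrier}
    (ha : x ∈ X.source a) (hb : x ∈ X.source b) (hc : x ∈ X.source c) (v : V) :
    fderiv ℝ (X.trans b c) (X.coord b x) (fderiv ℝ (X.trans a b) (X.coord a x) v) =
      fderiv ℝ (X.trans a c) (X.coord a x) v := by
  have h1 : X.trans a c =ᶠ[𝓝 (X.coord a x)] X.trans b c ∘ X.trans a b := by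
    filter_upwards [(h.isOpen_image a b).mem_nhds (coord_mem_image ha hb),
      (h.isOpen_image a c).mem_nhds (coord_mem_image ha hc)]
    rintro _ ⟨y, ⟨hyb, hya⟩, rfl⟩ hc'
    have hyc := (h.coord_mem_image_iff hya).1 hc'
    simp [h.trans_coord hya hyb, h.trans_coord hya hyc, h.trans_coord hyb hyc]
  have h2 : DifferentiableAt ℝ (X.trans b c) (X.trans a b (X.coord a x)) := by
    rw [h.trans_coord ha hb]
    exact h.differentiableAt_trans hb hc
  rw [h1.fderiv_eq, fderiv_comp _ h2 (h.differentiableAt_trans ha hb), h.trans_coord ha hb]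
  rfl

theorem IsSmooth.fderiv_trans_symm (h : X.IsSmooth) {a b : A} {x : X.carrier}
    (ha : x ∈ X.source a) (hb : x ∈ X.source b) (v : V) :
    fderiv ℝ (X.trans b a) (X.coord b x) (fderiv ℝ (X.trans a b) (X.coord a x) v) = v := by
  rw [h.fderiv_trans_trans ha hb ha, h.fderiv_trans_self ha]

theorem eq_of_apply_eq {x : X.carrier} {v w : A → V} (hv : v ∈ X.tangentSpace x)
    (hw : w ∈ X.tangentSpace x) {a : A} (ha : x ∈ X.source a) (hvw : v a = w a) : v = w := by
  funext b
  by_cases hb : x ∈ X.source b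
  · rw [hv.2 a b ha hb, hw.2 a b ha hb, hvw]
  · rw [hv.1 b hb, hw.1 b hb]

open Classical in
/-- The tangent vector at `x` with components `u` in the chart `a`. -/
def tangentVector (X : ChartSystem A V) (x : X.carrier) (a : A) : V →ₗ[ℝ] (A → V) where
  toFun u b := if x ∈ X.source b then fderiv ℝ (X.trans a b) (X.coord a x) u else 0
  map_add' u v := by
    funext b
    by_cases hb : x ∈ X.source b <;> simp [hb]
  map_smul' c u := by
    funext b
    by_cases hb : x ∈ X.source b <;> simp [hb]

theorem IsSmooth.tangentVector_mem (h : X.IsSmooth) {x : X.carrier} {a : A} (ha : x ∈ X.source a)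
    (u : V) : X.tangentVector x a u ∈ X.tangentSpace x := by
  refine ⟨fun b hb => by simp [tangentVector, hb], fun b c hb hc => ?_⟩
  simp [tangentVector, hb, hc, h.fderiv_trans_trans ha hb hc]

theorem IsSmooth.tangentVector_self (h : X.IsSmooth) {x : X.carrier} {a : A}
    (ha : x ∈ X.source a) (u : V) : X.tangentVector x a u a = u := by
  simp [tangentVector, ha, h.fderiv_trans_self ha]

/-- Tangency to a subset can be tested in a single chart. -/
theorem IsSmooth.mem_tangentTo_iff (h : X.IsSmooth) {x : X.carrier} {a : A} (ha : x ∈ X.source a)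
    {S : Set X.carrier} {v : A → V} (hv : v ∈ X.tangentSpace x) :
    v ∈ X.tangentTo S x ↔ HasVelocity (X.image a S) (X.coord a x) (v a) := by
  refine ⟨fun hv' => hv'.2 a ha, fun hva => ⟨hv, fun b hb => ?_⟩⟩
  have := hva.map (S' := X.image b S) (h.isOpen_image a b) (coord_mem_image ha hb)
    (h.contDiffOn_trans a b) ?_
  · rw [h.trans_coord ha hb, ← hv.2 a b ha hb] at this
    exact this
  · rintro _ ⟨⟨y, ⟨hyS, hya⟩, rfl⟩, hyb⟩
    have hyb' := (h.coord_mem_image_iff hya).1 hyb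
    rw [h.trans_coord hya hyb']
    exact coord_mem_image hyb' hyS

end ChartSystem

/-! ## Linear algebra of jets -/

section Jets

variable {n k : ℕ}

theorem MultiIndex.exists_incl_or_snoc (J : MultiIndex n (k + 1)) :
    (∃ I : MultiIndex n k, J = I.incl) ∨
      ∃ (I : MultiIndex n k) (i : Fin n), J = I.snoc i ∧ I.1.card = k := by
  by_cases h : J.1.card ≤ k
  · exact Or.inl ⟨⟨J.1, h⟩, rfl⟩
  · have hJ : J.1.card = k + 1 := le_antisymm J.2 (by omega)
    obtain ⟨i, hi⟩ := Multiset.card_pos_iff_exists_mem.1 (by omega : 0 < J.1.card)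
    have hc : (J.1.erase i).card = k := by
      rw [Multiset.card_erase_of_mem hi, hJ]; rfl
    exact Or.inr ⟨⟨J.1.erase i, hc.le⟩, i, Subtype.ext (Multiset.cons_erase hi).symm, hc⟩

theorem jet_ext {q q' : Jet n (k + 1)} (h : jetProj n k q = jetProj n k q')
    (h' : ∀ (I : MultiIndex n k) i, q.2 (I.snoc i) = q'.2 (I.snoc i)) : q = q' := by
  refine Prod.ext (congrArg Prod.fst h :) (funext fun J => ?_)
  rcases J.exists_incl_or_snoc with ⟨I, rfl⟩ | ⟨I, i, rfl, -⟩
  · exact congrFun (congrArg Prod.snd h :) I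
  · exact h' I i

@[simp] theorem totalVector_fst (q : Jet n (k + 1)) (i : Fin n) :
    (totalVector q i).1 = Pi.single i 1 := rfl

@[simp] theorem totalVector_snd (q : Jet n (k + 1)) (i : Fin n) (I : MultiIndex n k) :
    (totalVector q i).2 I = q.2 (I.snoc i) := rfl

@[simp] theorem jetProj_fst (q : Jet n (k + 1)) : (jetProj n k q).1 = q.1 := rfl

@[simp] theorem jetProj_snd (q : Jet n (k + 1)) (I : MultiIndex n k) :
    (jetProj n k q).2 I = q.2 I.incl := rfl

theorem MultiIndex.snoc_incl (I : MultiIndex n k) (i : Fin n) :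
    I.incl.snoc i = (I.snoc i).incl := rfl

theorem MultiIndex.snoc_comm (I : MultiIndex n k) (i j : Fin n) :
    (I.snoc i).snoc j = (I.snoc j).snoc i := Subtype.ext (Multiset.cons_swap _ _ _)

@[simp] theorem jetProj_totalVector (q : Jet n (k + 2)) (i : Fin n) :
    jetProj n k (totalVector q i) = totalVector (jetProj n (k + 1) q) i := rfl

theorem sum_smul_totalVector (q : Jet n (k + 1)) (c : Fin n → ℝ) :
    ∑ i, c i • totalVector q i = (c, fun I => ∑ i, q.2 (I.snoc i) * c i) := by
  refine Prod.ext ?_ ?_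
  · rw [Prod.fst_sum]
    funext j
    simp [Finset.sum_apply, Pi.single_apply]
  · rw [Prod.snd_sum]
    funext I
    simp [Finset.sum_apply, mul_comm]

theorem mem_jetPlane_iff (q : Jet n (k + 1)) (v : Jet n k) :
    v ∈ jetPlane q ↔ ∀ I, v.2 I = ∑ i, q.2 (I.snoc i) * v.1 i := by
  rw [jetPlane, Submodule.mem_span_range_iff_exists_fun]
  constructor
  · rintro ⟨c, rfl⟩ I
    rw [sum_smul_totalVector]
  · intro h
    exact ⟨v.1, by rw [sum_smul_totalVector]; exact Prod.ext rfl (funext fun I => (h I).symm)⟩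

theorem totalVector_mem_jetPlane (q : Jet n (k + 1)) (i : Fin n) :
    totalVector q i ∈ jetPlane q := Submodule.subset_span ⟨i, rfl⟩

theorem theta_eq_zero_iff (q v : Jet n (k + 1)) :
    (∀ I : MultiIndex n k, theta I q v = 0) ↔ jetProj n k v ∈ jetPlane q := by
  rw [mem_jetPlane_iff]
  simp [theta, sub_eq_zero]

theorem eq_zero_of_mem_jetPlane {q : Jet n (k + 1)} {v : Jet n k} (hv : v ∈ jetPlane q)
    (h : v.1 = 0) : v = 0 := by
  rw [mem_jetPlane_iff] at hv
  refine Prod.ext h (funext fun I => ?_)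
  rw [hv I, h]
  simp

theorem eq_of_jetPlane_le {q q' : Jet n (k + 1)} (h : jetProj n k q = jetProj n k q')
    (hP : jetPlane q ≤ jetPlane q') : q = q' := by
  refine jet_ext h fun I i => ?_
  have := (mem_jetPlane_iff q' _).1 (hP (totalVector_mem_jetPlane q i)) I
  simpa [Pi.single_apply] using this

theorem theta_totalPlane {q : Jet n (k + 2)} {v : Jet n (k + 1)} (hv : v ∈ jetPlane q)
    (I : MultiIndex n k) : theta I (jetProj n (k + 1) q) v = 0 := by
  rw [mem_jetPlane_iff] at hv
  rw [theta, hv I.incl]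
  simp [MultiIndex.snoc_incl]

/-- On the plane `dp_{I,i} = ∑_j p_{I,i,j} dxʲ`, and `∑ p_{I,i,j} dxʲ ∧ dxⁱ` vanishes by the
symmetry of `p_{I,i,j}` in `i, j`. -/
theorem dtheta_totalPlane {q : Jet n (k + 2)} {v w : Jet n (k + 1)} (hv : v ∈ jetPlane q)
    (hw : w ∈ jetPlane q) (I : MultiIndex n k) : dtheta I v w = 0 := by
  rw [mem_jetPlane_iff] at hv hw
  rw [dtheta, neg_eq_zero, Finset.sum_sub_distrib, sub_eq_zero]
  simp only [hv, hw, Finset.sum_mul]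
  rw [Finset.sum_comm]
  refine Finset.sum_congr rfl fun j _ => Finset.sum_congr rfl fun i _ => ?_
  rw [I.snoc_comm i j]
  ring

theorem finrank_jetPlane (q : Jet n (k + 1)) : Module.finrank ℝ (jetPlane q) = n := by
  have : LinearIndependent ℝ (totalVector q) := by
    refine LinearIndependent.of_comp (LinearMap.fst ℝ (Fin n → ℝ) (MultiIndex n k → ℝ)) ?_
    convert (Pi.basisFun ℝ (Fin n)).linearIndependent using 1
    funext i
    simp
  rw [jetPlane, finrank_span_eq_card this, Fintype.card_fin]

/-- An `n`-dimensional plane that is transversal to the fibres of the projection to the `xⁱ` and on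
which the forms `θ_I` and `dθ_I` vanish has coordinates. -/
theorem exists_eq_jetPlane (p : Jet n (k + 1)) (P : Submodule ℝ (Jet n (k + 1)))
    (hrank : Module.finrank ℝ P = n)
    (hθ : ∀ v ∈ P, ∀ I : MultiIndex n k, theta I p v = 0)
    (hdθ : ∀ v ∈ P, ∀ w ∈ P, ∀ I : MultiIndex n k, dtheta I v w = 0)
    (hinj : ∀ v ∈ P, v.1 = 0 → v = 0) :
    ∃ q : Jet n (k + 2), jetProj n (k + 1) q = p ∧ P = jetPlane q := by
  classical
  let f : P →ₗ[ℝ] (Fin n → ℝ) := (LinearMap.fst ℝ _ _) ∘ₗ P.subtype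
  have hf : Function.Injective f := by
    rw [← LinearMap.ker_eq_bot, LinearMap.ker_eq_bot']
    exact fun v hv => Subtype.ext (hinj v v.2 hv)
  have hfs : Function.Surjective f :=
    (LinearMap.injective_iff_surjective_of_finrank_eq_finrank (by simp [hrank])).1 hf
  -- By its dimension `P` is a graph over the space of the `xⁱ`; the `u i` are the lifts of the
  -- standard basis and will turn out to be the vectors `totalVector q i`.
  choose u hu using fun i : Fin n => hfs (Pi.single i 1)
  have hu1 : ∀ i, (u i).1.1 = Pi.single i 1 := hu
  have hu2 : ∀ i (I : MultiIndex n k), (u i).1.2 I.incl = p.2 (I.snoc i) := by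
    intro i I
    have := hθ _ (u i).2 I
    rw [theta, hu1, sub_eq_zero] at this
    simpa [Pi.single_apply] using this
  have hu3 : ∀ i j (I : MultiIndex n k), (u i).1.2 (I.snoc j) = (u j).1.2 (I.snoc i) := by
    intro i j I
    have := hdθ _ (u i).2 _ (u j).2 I
    rw [dtheta, hu1, hu1, neg_eq_zero, Finset.sum_sub_distrib, sub_eq_zero] at this
    simpa [Pi.single_apply] using this
  -- A top coordinate `p_J` is read off from `u i` at `J` without `i`, for an arbitrary `i ∈ J`. The
  -- symmetry `hu3`, which comes from the `dθ_I`, makes the choice immaterial.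
  let top : ∀ J : MultiIndex n (k + 2), ¬ J.1.card ≤ k + 1 → Fin n := fun J hJ =>
    (Multiset.card_pos_iff_exists_mem.1 (by omega : 0 < J.1.card)).choose
  have htop : ∀ J hJ, top J hJ ∈ J.1 := fun J hJ =>
    (Multiset.card_pos_iff_exists_mem.1 (by omega : 0 < J.1.card)).choose_spec
  let q : Jet n (k + 2) := (p.1, fun J => if hJ : J.1.card ≤ k + 1 then p.2 ⟨J.1, hJ⟩ else
    (u (top J hJ)).1.2 ⟨J.1.erase (top J hJ), by
      rw [Multiset.card_erase_of_mem (htop J hJ)]; exact Nat.pred_le_iff.2 J.2⟩)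
  have hq1 : jetProj n (k + 1) q = p := by
    refine Prod.ext rfl (funext fun I => ?_)
    have : I.incl.1.card ≤ k + 1 := I.2
    simp only [jetProj_snd, q]
    rw [dif_pos this]
    rfl
  have hq2 : ∀ (I : MultiIndex n (k + 1)) i, q.2 (I.snoc i) = (u i).1.2 I := by
    intro I i
    by_cases hI : I.1.card ≤ k
    · obtain ⟨I', rfl⟩ : ∃ I' : MultiIndex n k, I = I'.incl := ⟨⟨I.1, hI⟩, rfl⟩
      rw [hu2, ← hq1]
      rfl
    · have hJ : ¬ (I.snoc i).1.card ≤ k + 1 := by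
        simp only [MultiIndex.snoc, Multiset.card_cons]; omega
      simp only [q]
      rw [dif_neg hJ]
      suffices H : ∀ j ∈ (I.snoc i).1, ∀ hc : ((I.snoc i).1.erase j).card ≤ k + 1,
          (u j).1.2 ⟨(I.snoc i).1.erase j, hc⟩ = (u i).1.2 I from H _ (htop _ hJ) _
      intro j hj hc'
      by_cases hji : j = i
      · subst hji
        exact congrArg (u j).1.2 (Subtype.ext (Multiset.erase_cons_head _ _))
      · have hjI : j ∈ I.1 := (Multiset.mem_cons.1 hj).resolve_left hji
        have hc : (I.1.erase j).card ≤ k := by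
          rw [Multiset.card_erase_of_mem hjI]; exact Nat.sub_le_of_le_add I.2
        have h1 : I = MultiIndex.snoc (⟨I.1.erase j, hc⟩ : MultiIndex n k) j :=
          Subtype.ext (Multiset.cons_erase hjI).symm
        conv_rhs => rw [h1, hu3]
        exact congrArg (u j).1.2 (Subtype.ext (Multiset.erase_cons_tail _ (Ne.symm hji)))
  have hq3 : ∀ i, totalVector q i = u i := fun i =>
    Prod.ext (hu1 i).symm (funext fun I => hq2 I i)
  have hfin : FiniteDimensional ℝ P := inferInstance
  refine ⟨q, hq1, (Submodule.eq_of_le_of_finrank_eq ?_ ?_).symm⟩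
  · rw [jetPlane, Submodule.span_le]
    rintro _ ⟨i, rfl⟩
    rw [hq3]
    exact (u i).2
  · rw [finrank_jetPlane, hrank]

end Jets

/-! ## Maps that preserve the contact system -/

section Contact

variable {n k : ℕ}

/-- The linear part of the extension of a vector `v` to a field on which the `θ_I` vanish. -/
def contactField (v : Jet n (k + 1)) : Jet n (k + 1) →ₗ[ℝ] Jet n (k + 1) where
  toFun q := (0, fun J => if h : J.1.card ≤ k then
    ∑ i, q.2 (MultiIndex.snoc (⟨J.1, h⟩ : MultiIndex n k) i) * v.1 i else 0)
  map_add' p q := by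
    refine Prod.ext (by simp) (funext fun J => ?_)
    by_cases h : J.1.card ≤ k <;> simp [h, add_mul, Finset.sum_add_distrib]
  map_smul' c q := by
    refine Prod.ext (by simp) (funext fun J => ?_)
    by_cases h : J.1.card ≤ k <;> simp [h, mul_assoc, Finset.mul_sum]

/-- The form `θ_I` depends on the base point only through the terms `p_{I,i} dxⁱ`. The correction
compensates for their change, and it creates no new ones because its `x`-part is zero. -/
theorem theta_contactField (q q' v : Jet n (k + 1)) (I : MultiIndex n k) :
    theta I q' (v + contactField v (q' - q)) = theta I q v := by
  have h : I.incl.1.card ≤ k := I.2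
  have h2 : (⟨I.incl.1, h⟩ : MultiIndex n k) = I := rfl
  simp [theta, contactField, h, h2, sub_mul, Finset.sum_sub_distrib]
  ring

/-- Equivalently, the Lie bracket at `q` of the affine extensions of `v` and `w` vanishes. -/
theorem contactField_comm {v w : Jet n (k + 1)} (h : ∀ I : MultiIndex n k, dtheta I v w = 0) :
    contactField v w = contactField w v := by
  refine Prod.ext rfl (funext fun J => ?_)
  by_cases hJ : J.1.card ≤ k
  · have := h ⟨J.1, hJ⟩
    rw [dtheta, neg_eq_zero, Finset.sum_sub_distrib, sub_eq_zero] at this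
    simp [contactField, hJ, this]
  · simp [contactField, hJ]

/-- If the derivative of `T` preserves the kernel of the `θ_I`, it preserves the relations
`dθ_I(v, w) = 0` between vectors of this kernel. -/
theorem dtheta_map_eq_zero {T : Jet n (k + 1) → Jet n (k + 1)} {O : Set (Jet n (k + 1))}
    (hO : IsOpen O) (hT : ContDiffOn ℝ ∞ T O)
    (hθ : ∀ q ∈ O, ∀ v, (∀ I : MultiIndex n k, theta I q v = 0) →
      ∀ I : MultiIndex n k, theta I (T q) (fderiv ℝ T q v) = 0)
    {q v w : Jet n (k + 1)} (hq : q ∈ O) (hv : ∀ I : MultiIndex n k, theta I q v = 0)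
    (hw : ∀ I : MultiIndex n k, theta I q w = 0) (hvw : ∀ I : MultiIndex n k, dtheta I v w = 0)
    (I : MultiIndex n k) : dtheta I (fderiv ℝ T q v) (fderiv ℝ T q w) = 0 := by
  have hTq : ContDiffAt ℝ ∞ T q := hT.contDiffAt (hO.mem_nhds hq)
  have hd2 : HasFDerivAt (fderiv ℝ T) (fderiv ℝ (fderiv ℝ T) q) q :=
    ((hTq.fderiv_right (m := ∞) (by simp)).differentiableAt (by simp)).hasFDerivAt
  have hd1 : HasFDerivAt T (fderiv ℝ T q) q := (hTq.differentiableAt (by simp)).hasFDerivAt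
  -- Extend `v` to the affine field annihilated by all `θ_I`. Its image under the derivative of `T`
  -- is again annihilated, and differentiating this identity along the line `q + t w` gives the
  -- formula.
  have key : ∀ v w : Jet n (k + 1), (∀ I : MultiIndex n k, theta I q v = 0) →
      (fderiv ℝ (fderiv ℝ T) q w v + fderiv ℝ T q (contactField v w)).2 I.incl =
        ∑ l, ((fderiv ℝ T q w).2 (I.snoc l) * (fderiv ℝ T q v).1 l + (T q).2 (I.snoc l) *
          (fderiv ℝ (fderiv ℝ T) q w v + fderiv ℝ T q (contactField v w)).1 l) := by
    intro v w hv
    have hline : HasDerivAt (fun t : ℝ => q + t • w) w 0 := by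
      simpa using ((hasDerivAt_id (0 : ℝ)).smul_const w).const_add q
    have h0 : q + (0 : ℝ) • w = q := by simp
    have hT1 : HasDerivAt (fun t : ℝ => T (q + t • w)) (fderiv ℝ T q w) 0 :=
      HasFDerivAt.comp_hasDerivAt (0 : ℝ) (l := T) (by rw [h0]; exact hd1) hline
    have hT2 : HasDerivAt (fun t : ℝ => fderiv ℝ T (q + t • w)) (fderiv ℝ (fderiv ℝ T) q w) 0 :=
      HasFDerivAt.comp_hasDerivAt (0 : ℝ) (l := fderiv ℝ T) (by rw [h0]; exact hd2) hline
    have hV : HasDerivAt (fun t : ℝ => v + t • contactField v w) (contactField v w) 0 := by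
      simpa using ((hasDerivAt_id (0 : ℝ)).smul_const (contactField v w)).const_add v
    have hg := hT2.clm_apply hV
    simp only [zero_smul, add_zero] at hg
    have hcoord : ∀ {f : ℝ → Jet n (k + 1)} {f' : Jet n (k + 1)} (J : MultiIndex n (k + 1)),
        HasDerivAt f f' 0 → HasDerivAt (fun t => (f t).2 J) (f'.2 J) 0 := fun J hf =>
      ((ContinuousLinearMap.proj (R := ℝ) J).comp
        (ContinuousLinearMap.snd ℝ (Fin n → ℝ) (MultiIndex n (k + 1) → ℝ))).hasFDerivAt
          |>.comp_hasDerivAt (0 : ℝ) hf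
    have hcoord1 : ∀ {f : ℝ → Jet n (k + 1)} {f' : Jet n (k + 1)} (l : Fin n),
        HasDerivAt f f' 0 → HasDerivAt (fun t => (f t).1 l) (f'.1 l) 0 := fun l hf =>
      ((ContinuousLinearMap.proj (R := ℝ) l).comp
        (ContinuousLinearMap.fst ℝ (Fin n → ℝ) (MultiIndex n (k + 1) → ℝ))).hasFDerivAt
          |>.comp_hasDerivAt (0 : ℝ) hf
    have hL := hcoord I.incl hg
    have hR := HasDerivAt.fun_sum (u := Finset.univ) fun l _ =>
      (hcoord (I.snoc l) hT1).mul (hcoord1 l hg)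
    have heq : (fun t : ℝ => (fderiv ℝ T (q + t • w) (v + t • contactField v w)).2 I.incl)
        =ᶠ[𝓝 0] fun t : ℝ => ∑ l, (T (q + t • w)).2 (I.snoc l) *
          (fderiv ℝ T (q + t • w) (v + t • contactField v w)).1 l := by
      have : ∀ᶠ t in 𝓝 (0 : ℝ), q + t • w ∈ O :=
        hline.continuousAt.eventually_mem (by rw [h0]; exact hO.mem_nhds hq)
      filter_upwards [this] with t ht
      have h3 := hθ _ ht (v + t • contactField v w) (fun J => by
        have := theta_contactField q (q + t • w) v J
        rw [add_sub_cancel_left, map_smul] at this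
        rw [this, hv]) I
      rwa [theta, sub_eq_zero] at h3
    have hu := hL.unique (hR.congr_of_eventuallyEq heq)
    simpa using hu
  -- Exchanging `v` and `w` in `key` changes neither the second derivative (symmetry) nor the
  -- `contactField` term (zero bracket). The difference of the two formulas is then exactly the
  -- claim about `dθ_I`.
  have hsymm : fderiv ℝ (fderiv ℝ T) q w v = fderiv ℝ (fderiv ℝ T) q v w :=
    (hTq.isSymmSndFDerivAt (by
      rw [minSmoothness_of_isRCLikeNormedField]; exact WithTop.coe_le_coe.2 (le_top : (2 : ℕ∞) ≤ ⊤))) w v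
  have h1 := key v w hv
  have h2 := key w v hw
  rw [contactField_comm hvw, hsymm] at h1
  rw [h1, Finset.sum_add_distrib, Finset.sum_add_distrib, add_left_inj] at h2
  rw [dtheta, neg_eq_zero, Finset.sum_sub_distrib, sub_eq_zero]
  exact h2.symm

end Contact

/-! ## Prolongation of contact chart systems -/

section Prolong

variable {A : Type u} {n k : ℕ} {X : ChartSystem A (Jet n (k + 1))}

/-- The changes of coordinates are smooth and preserve the contact system and, for `k ≥ 1`, the
fibres of the projection to the jets of lower order. -/
structure IsContactSystem (X : ChartSystem A (Jet n (k + 1))) : Prop extends X.IsSmooth where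
  theta_trans : ∀ a b x, x ∈ X.source a → x ∈ X.source b → ∀ v,
    (∀ I : MultiIndex n k, theta I (X.coord a x) v = 0) →
      ∀ I : MultiIndex n k, theta I (X.coord b x) (fderiv ℝ (X.trans a b) (X.coord a x) v) = 0
  vertical : 1 ≤ k → ∀ a b x, x ∈ X.source a → x ∈ X.source b → ∀ v, jetProj n k v = 0 →
    jetProj n k (fderiv ℝ (X.trans a b) (X.coord a x) v) = 0

theorem IsContactSystem.dtheta_trans (h : IsContactSystem X) {a b : A} {x : X.carrier}
    (ha : x ∈ X.source a) (hb : x ∈ X.source b) {v w : Jet n (k + 1)}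
    (hv : ∀ I : MultiIndex n k, theta I (X.coord a x) v = 0)
    (hw : ∀ I : MultiIndex n k, theta I (X.coord a x) w = 0)
    (hvw : ∀ I : MultiIndex n k, dtheta I v w = 0) (I : MultiIndex n k) :
    dtheta I (fderiv ℝ (X.trans a b) (X.coord a x) v)
      (fderiv ℝ (X.trans a b) (X.coord a x) w) = 0 := by
  refine dtheta_map_eq_zero (h.isOpen_image a b) (h.contDiffOn_trans a b) ?_
    (ChartSystem.coord_mem_image ha hb) hv hw hvw I
  rintro _ ⟨y, ⟨hyb, hya⟩, rfl⟩ v hv I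
  rw [h.trans_coord hya hyb]
  exact h.theta_trans a b y hya hyb v hv I

/-- Thanks to this, the `Classical.epsilon` in the coordinates of `prolong X` returns the
coordinates of the plane. -/
theorem IsPlaneCoord.unique {a : A} {x : X.carrier} {L : Submodule ℝ (A → Jet n (k + 1))}
    {q q' : Jet n (k + 2)} (h : IsPlaneCoord X a x L q) (h' : IsPlaneCoord X a x L q') :
    q = q' :=
  eq_of_jetPlane_le (h.2.1.trans h'.2.1.symm) (h.2.2.symm.trans h'.2.2).le

theorem isPlaneCoord_coord {a : A} {y : (prolong X).carrier} (hy : y ∈ (prolong X).source a) :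
    IsPlaneCoord X a (basePoint y) (plane y) ((prolong X).coord a y) :=
  Classical.epsilon_spec hy

theorem IsPlaneCoord.coord_eq {a : A} {y : (prolong X).carrier} {q : Jet n (k + 2)}
    (h : IsPlaneCoord X a (basePoint y) (plane y) q) : (prolong X).coord a y = q :=
  (isPlaneCoord_coord ⟨q, h⟩).unique h

theorem basePoint_mem_source {a : A} {y : (prolong X).carrier}
    (hy : y ∈ (prolong X).source a) : basePoint y ∈ X.source a := (isPlaneCoord_coord hy).1

theorem jetProj_coord {a : A} {y : (prolong X).carrier} (hy : y ∈ (prolong X).source a) :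
    jetProj n (k + 1) ((prolong X).coord a y) = X.coord a (basePoint y) :=
  (isPlaneCoord_coord hy).2.1

theorem map_plane {a : A} {y : (prolong X).carrier} (hy : y ∈ (prolong X).source a) :
    (plane y).map (LinearMap.proj (R := ℝ) (φ := fun _ : A => Jet n (k + 1)) a) =
      jetPlane ((prolong X).coord a y) :=
  (isPlaneCoord_coord hy).2.2

theorem apply_mem_jetPlane {a : A} {y : (prolong X).carrier} (hy : y ∈ (prolong X).source a)
    {v : A → Jet n (k + 1)} (hv : v ∈ plane y) : v a ∈ jetPlane ((prolong X).coord a y) := by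
  rw [← map_plane hy]
  exact ⟨v, hv, rfl⟩

theorem exists_mem_plane {a : A} {y : (prolong X).carrier} (hy : y ∈ (prolong X).source a)
    {u : Jet n (k + 1)} (hu : u ∈ jetPlane ((prolong X).coord a y)) :
    ∃ v ∈ plane y, v a = u := by
  rw [← map_plane hy] at hu
  exact hu

/-- Every jet over a point is the jet of a Lagrangian plane at this point. -/
theorem IsContactSystem.exists_coord_eq (h : IsContactSystem X) {a : A} {x : X.carrier}
    (ha : x ∈ X.source a) {q : Jet n (k + 2)} (hq : jetProj n (k + 1) q = X.coord a x) :
    ∃ y : (prolong X).carrier, basePoint y = x ∧ y ∈ (prolong X).source a ∧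
      (prolong X).coord a y = q := by
  have hinj : Function.Injective (X.tangentVector x a) := fun u u' huu' => by
    rw [← h.tangentVector_self ha u, huu', h.tangentVector_self ha]
  have happ : ∀ {b}, x ∈ X.source b → ∀ u, X.tangentVector x a u b =
      fderiv ℝ (X.trans a b) (X.coord a x) u := fun hb u => by
    simp [ChartSystem.tangentVector, hb]
  have hθ : ∀ u ∈ jetPlane q, ∀ I : MultiIndex n k, theta I (X.coord a x) u = 0 := by
    intro u hu I
    rw [← hq]
    exact theta_totalPlane hu I
  have hL : IsLagrangianPlane X x ((jetPlane q).map (X.tangentVector x a)) := by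
    have hrank : Module.finrank ℝ ((jetPlane q).map (X.tangentVector x a)) = n := by
      rw [← (Submodule.equivMapOfInjective _ hinj (jetPlane q)).finrank_eq, finrank_jetPlane]
    refine ⟨?_, hrank, ?_, ?_, ?_, ?_⟩
    · rintro _ ⟨u, -, rfl⟩
      exact h.tangentVector_mem ha u
    · exact inferInstance
    · rintro _ ⟨u, hu, rfl⟩ b hb I
      rw [happ hb]
      exact h.theta_trans a b x ha hb u (hθ u hu) I
    · rintro _ ⟨u, hu, rfl⟩ _ ⟨w, hw, rfl⟩ b hb I
      rw [happ hb, happ hb]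
      exact h.dtheta_trans ha hb (hθ u hu) (hθ w hw) (dtheta_totalPlane hu hw) I
    · rintro hk _ ⟨u, hu, rfl⟩ b hb hv
      rw [happ hb] at hv
      -- A vector that is vertical in the chart `b` is vertical in the chart `a`, where the plane is
      -- a graph over the `xⁱ`.
      have h0 := h.vertical hk b a x hb ha _ hv
      rw [h.fderiv_trans_symm ha hb] at h0
      have hu0 : u = 0 := eq_zero_of_mem_jetPlane hu (congrArg Prod.fst h0 :)
      rw [hu0, map_zero]
  have hc : IsPlaneCoord X a x ((jetPlane q).map (X.tangentVector x a)) q := by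
    refine ⟨ha, hq, ?_⟩
    rw [← Submodule.map_comp]
    have hid : LinearMap.proj (R := ℝ) (φ := fun _ : A => Jet n (k + 1)) a ∘ₗ
        X.tangentVector x a = LinearMap.id :=
      LinearMap.ext fun u => h.tangentVector_self ha u
    rw [hid, Submodule.map_id]
  exact ⟨⟨(x, _), hL⟩, rfl, ⟨q, hc⟩, IsPlaneCoord.coord_eq (y := ⟨(x, _), hL⟩) hc⟩

/-- A Lagrangian plane that is transversal to the fibres of the projection to the `xⁱ` in a chart
belongs to the induced chart. -/
theorem mem_source_prolong {a : A} {y : (prolong X).carrier} (ha : basePoint y ∈ X.source a)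
    (hy : ∀ v ∈ plane y, (v a).1 = 0 → v a = 0) : y ∈ (prolong X).source a := by
  have hL : IsLagrangianPlane X (basePoint y) (plane y) := y.2
  have hinj : Function.Injective
      ((LinearMap.proj (R := ℝ) (φ := fun _ : A => Jet n (k + 1)) a).domRestrict (plane y)) :=
    fun v w hvw => Subtype.ext (ChartSystem.eq_of_apply_eq (hL.le_tangentSpace v.2)
      (hL.le_tangentSpace w.2) ha hvw)
  have hrank : Module.finrank ℝ
      ((plane y).map (LinearMap.proj (R := ℝ) (φ := fun _ : A => Jet n (k + 1)) a)) = n := by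
    rw [← LinearMap.range_domRestrict, LinearMap.finrank_range_of_inj hinj, hL.finrank_eq]
  obtain ⟨q, hq, hP⟩ := exists_eq_jetPlane (X.coord a (basePoint y)) _ hrank
    (by rintro _ ⟨v, hv, rfl⟩ I; exact hL.theta_eq_zero v hv a ha I)
    (by rintro _ ⟨v, hv, rfl⟩ _ ⟨w, hw, rfl⟩ I; exact hL.dtheta_eq_zero v hv w hw a ha I)
    (by rintro _ ⟨v, hv, rfl⟩ h0; exact hy v hv h0)
  exact ⟨q, ha, hq, hP⟩

/-- For `k ≥ 1` the domain of an induced chart consists of all Lagrangian planes at the points of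
the domain of the original chart. -/
theorem mem_source_prolong_iff (hk : 1 ≤ k) {a : A} {y : (prolong X).carrier} :
    y ∈ (prolong X).source a ↔ basePoint y ∈ X.source a := by
  refine ⟨basePoint_mem_source, fun ha => mem_source_prolong ha fun v hv hv0 => ?_⟩
  have hL : IsLagrangianPlane X (basePoint y) (plane y) := y.2
  -- The vanishing of the `θ_I` puts the projection of `v` into a plane that is a graph over the
  -- `xⁱ`. If the `x`-part of `v` is zero, so is this projection, and horizontality gives `v = 0`.
  have h1 := (theta_eq_zero_iff _ _).1 (hL.theta_eq_zero v hv a ha)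
  rw [hL.horizontal hk v hv a ha (eq_zero_of_mem_jetPlane h1 hv0)]
  rfl

theorem injOn_coord_prolong (h : IsContactSystem X) (a : A) :
    InjOn ((prolong X).coord a) ((prolong X).source a) := by
  intro y hy z hz hyz
  have hx : basePoint y = basePoint z := by
    refine h.injOn a (basePoint_mem_source hy) (basePoint_mem_source hz) ?_
    rw [← jetProj_coord hy, ← jetProj_coord hz, hyz]
  have hle : ∀ {y z : (prolong X).carrier}, y ∈ (prolong X).source a → z ∈ (prolong X).source a →
      (prolong X).coord a y = (prolong X).coord a z → basePoint y = basePoint z →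
      plane y ≤ plane z := by
    intro y z hy hz hyz hx v hv
    have hLy : IsLagrangianPlane X (basePoint y) (plane y) := y.2
    have hLz : IsLagrangianPlane X (basePoint z) (plane z) := z.2
    obtain ⟨w, hw, hwv⟩ := exists_mem_plane hz (hyz ▸ apply_mem_jetPlane hy hv)
    have hvz : v ∈ X.tangentSpace (basePoint z) := by rw [← hx]; exact hLy.le_tangentSpace hv
    rwa [ChartSystem.eq_of_apply_eq hvz (hLz.le_tangentSpace hw) (basePoint_mem_source hz)
      hwv.symm]
  exact Subtype.ext (Prod.ext hx (le_antisymm (hle hy hz hyz hx) (hle hz hy hyz.symm hx.symm)))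

/-- The parametrization of the plane with coordinates `q` by the `xⁱ`. -/
def planeMap (q : Jet n (k + 1)) : (Fin n → ℝ) →L[ℝ] Jet n k :=
  ∑ i, (ContinuousLinearMap.proj (R := ℝ) (φ := fun _ : Fin n => ℝ) i).smulRight (totalVector q i)

theorem planeMap_apply (q : Jet n (k + 1)) (c : Fin n → ℝ) :
    planeMap q c = (c, fun I => ∑ i, q.2 (I.snoc i) * c i) := by
  rw [← sum_smul_totalVector]
  simp [planeMap]

theorem planeMap_mem (q : Jet n (k + 1)) (c : Fin n → ℝ) : planeMap q c ∈ jetPlane q := by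
  rw [mem_jetPlane_iff, planeMap_apply]
  exact fun _ => rfl

theorem planeMap_fst {q : Jet n (k + 1)} {v : Jet n k} (hv : v ∈ jetPlane q) :
    planeMap q v.1 = v := by
  rw [mem_jetPlane_iff] at hv
  rw [planeMap_apply]
  exact Prod.ext rfl (funext fun I => (hv I).symm)

theorem contDiff_totalVector (i : Fin n) :
    ContDiff ℝ ∞ fun q : Jet n (k + 1) => totalVector q i := by
  unfold totalVector
  fun_prop

theorem contDiff_planeMap : ContDiff ℝ ∞ (planeMap : Jet n (k + 1) → _) := by
  unfold planeMap
  refine ContDiff.sum fun i _ => ?_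
  exact ContDiff.smulRight contDiff_const (contDiff_totalVector i)

theorem continuous_jetProj : Continuous (jetProj n k) :=
  (LinearMap.toContinuousLinearMap (jetProj n k)).continuous

theorem contDiff_jetProj : ContDiff ℝ ∞ (jetProj n k) :=
  (LinearMap.toContinuousLinearMap (jetProj n k)).contDiff

theorem hasFDerivAt_jetProj (q : Jet n (k + 1)) :
    HasFDerivAt (jetProj n k) (LinearMap.toContinuousLinearMap (jetProj n k)) q :=
  (LinearMap.toContinuousLinearMap (jetProj n k)).hasFDerivAt

/-- The derivative of a change of coordinates on the plane with coordinates `q`, in terms of the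
coordinates `xⁱ` on both sides. -/
def planeTrans (X : ChartSystem A (Jet n (k + 1))) (a b : A) (q : Jet n (k + 2)) :
    (Fin n → ℝ) →L[ℝ] (Fin n → ℝ) :=
  (ContinuousLinearMap.fst ℝ (Fin n → ℝ) (MultiIndex n (k + 1) → ℝ)).comp
    ((fderiv ℝ (X.trans a b) (jetProj n (k + 1) q)).comp (planeMap q))

theorem fderiv_trans_mem_jetPlane {a b : A} {y : (prolong X).carrier}
    (ha : y ∈ (prolong X).source a) (hb : y ∈ (prolong X).source b) {u : Jet n (k + 1)}
    (hu : u ∈ jetPlane ((prolong X).coord a y)) :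
    fderiv ℝ (X.trans a b) (X.coord a (basePoint y)) u ∈ jetPlane ((prolong X).coord b y) := by
  have hL : IsLagrangianPlane X (basePoint y) (plane y) := y.2
  obtain ⟨v, hv, rfl⟩ := exists_mem_plane ha hu
  rw [← (hL.le_tangentSpace hv).2 a b (basePoint_mem_source ha) (basePoint_mem_source hb)]
  exact apply_mem_jetPlane hb hv

theorem mem_range_coe_of_injective {E : Type*} [NormedAddCommGroup E] [NormedSpace ℝ E]
    [FiniteDimensional ℝ E] {f : E →L[ℝ] E} (hf : Function.Injective f) :
    f ∈ range ((↑) : (E ≃L[ℝ] E) → E →L[ℝ] E) :=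
  ⟨(LinearEquiv.ofInjectiveEndo f.toLinearMap hf).toContinuousLinearEquiv,
    ContinuousLinearMap.ext fun _ => rfl⟩

/-- A plane that is a graph over the `xⁱ` in the chart `a` is also one in the chart `b` exactly when
the induced map between the two spaces of `xⁱ` is invertible. Invertibility is an open condition, so
overlaps of induced charts are open. -/
theorem image_source_prolong (h : IsContactSystem X) (a b : A) :
    (prolong X).image a ((prolong X).source b) =
      {q | jetProj n (k + 1) q ∈ X.image a (X.source b) ∧ planeTrans X a b q ∈
        range ((↑) : ((Fin n → ℝ) ≃L[ℝ] (Fin n → ℝ)) → (Fin n → ℝ) →L[ℝ] (Fin n → ℝ))} := by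
  ext q
  constructor
  · rintro ⟨y, ⟨hb, ha⟩, rfl⟩
    have hab := basePoint_mem_source ha
    have hbb := basePoint_mem_source hb
    refine ⟨?_, mem_range_coe_of_injective ?_⟩
    · rw [jetProj_coord ha]
      exact ChartSystem.coord_mem_image hab hbb
    · refine (injective_iff_map_eq_zero _).2 fun c hc => ?_
      have hu := planeMap_mem ((prolong X).coord a y) c
      have h1 := fderiv_trans_mem_jetPlane ha hb hu
      rw [← jetProj_coord ha] at h1
      have h2 := eq_zero_of_mem_jetPlane h1 hc
      rw [jetProj_coord ha] at h2
      have h3 := h.fderiv_trans_symm hab hbb (planeMap ((prolong X).coord a y) c)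
      rw [h2, map_zero, planeMap_apply] at h3
      exact (congrArg Prod.fst h3 :).symm
  · rintro ⟨⟨x, ⟨hxb, hxa⟩, hx⟩, e, he⟩
    obtain ⟨y, rfl, hy, rfl⟩ := h.exists_coord_eq hxa hx.symm
    refine ⟨y, ⟨mem_source_prolong hxb fun v hv hv0 => ?_, hy⟩, rfl⟩
    have hL : IsLagrangianPlane X (basePoint y) (plane y) := y.2
    have hva := apply_mem_jetPlane hy hv
    have h1 := (hL.le_tangentSpace hv).2 a b hxa hxb
    have h2 : planeTrans X a b ((prolong X).coord a y) (v a).1 = 0 := by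
      simp only [planeTrans, ContinuousLinearMap.comp_apply, planeMap_fst hva]
      rw [← hx, ← h1]
      exact hv0
    rw [← he] at h2
    have h3 : (v a).1 = 0 := e.map_eq_zero_iff.1 h2
    rw [h1, eq_zero_of_mem_jetPlane hva h3, map_zero]

theorem jetProj_trans (h : IsContactSystem X) {a b : A} (q : Jet n (k + 2))
    (hq : q ∈ (prolong X).image a ((prolong X).source b)) :
    jetProj n (k + 1) ((prolong X).trans a b q) = X.trans a b (jetProj n (k + 1) q) := by
  obtain ⟨y, ⟨hb, ha⟩, rfl⟩ := hq
  rw [ChartSystem.trans_coord (injOn_coord_prolong h a) ha hb, jetProj_coord ha, jetProj_coord hb,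
    h.trans_coord (basePoint_mem_source ha) (basePoint_mem_source hb)]

theorem contDiffOn_planeTrans (h : IsContactSystem X) (a b : A) :
    ContDiffOn ℝ ∞ (planeTrans X a b)
      (jetProj n (k + 1) ⁻¹' X.image a (X.source b)) := by
  refine contDiffOn_const.clm_comp (ContDiffOn.clm_comp ?_ contDiff_planeMap.contDiffOn)
  exact (ContDiffOn.fderiv_of_isOpen (h.contDiffOn_trans a b) (h.isOpen_image a b)
    (m := ∞) (by simp)).comp contDiff_jetProj.contDiffOn (fun _ hq => hq)

theorem isOpen_image_prolong (h : IsContactSystem X) (a b : A) :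
    IsOpen ((prolong X).image a ((prolong X).source b)) := by
  rw [image_source_prolong h]
  exact (contDiffOn_planeTrans h a b).continuousOn.isOpen_inter_preimage
    ((h.isOpen_image a b).preimage continuous_jetProj) (ContinuousLinearEquiv.isOpen)

/-- The new coordinates `p_{I,i}` are components of the vector of the transported plane whose
`x`-part is the `i`-th basis vector. Inverting `planeTrans` finds this vector, so the coordinate
change is visibly smooth. -/
theorem trans_prolong_snoc (h : IsContactSystem X) {a b : A} {q : Jet n (k + 2)}
    (hq : q ∈ (prolong X).image a ((prolong X).source b)) (I : MultiIndex n (k + 1)) (i : Fin n) :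
    ((prolong X).trans a b q).2 (I.snoc i) =
      (fderiv ℝ (X.trans a b) (jetProj n (k + 1) q)
        (planeMap q ((planeTrans X a b q).inverse (Pi.single i 1)))).2 I := by
  have hq' := hq
  rw [image_source_prolong h] at hq'
  obtain ⟨-, e, he⟩ := hq'
  obtain ⟨y, ⟨hb, ha⟩, rfl⟩ := hq
  rw [ChartSystem.trans_coord (injOn_coord_prolong h a) ha hb]
  set q := (prolong X).coord a y
  have h1 := fderiv_trans_mem_jetPlane ha hb
    (planeMap_mem q ((planeTrans X a b q).inverse (Pi.single i 1)))
  rw [← jetProj_coord ha] at h1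
  have h2 : (fderiv ℝ (X.trans a b) (jetProj n (k + 1) q)
      (planeMap q ((planeTrans X a b q).inverse (Pi.single i 1)))).1 = Pi.single i 1 := by
    change planeTrans X a b q ((planeTrans X a b q).inverse (Pi.single i 1)) = _
    rw [← he, ContinuousLinearMap.inverse_equiv]
    simp
  rw [(mem_jetPlane_iff _ _).1 h1 I, h2]
  simp [Pi.single_apply]

theorem contDiffOn_trans_prolong (h : IsContactSystem X) (a b : A) :
    ContDiffOn ℝ ∞ ((prolong X).trans a b) ((prolong X).image a ((prolong X).source b)) := by
  have hsub : ∀ q ∈ (prolong X).image a ((prolong X).source b),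
      jetProj n (k + 1) q ∈ X.image a (X.source b) := fun q hq => by
    rw [image_source_prolong h] at hq
    exact hq.1
  have hlow : ContDiffOn ℝ ∞ (fun q => X.trans a b (jetProj n (k + 1) q))
      ((prolong X).image a ((prolong X).source b)) :=
    (h.contDiffOn_trans a b).comp contDiff_jetProj.contDiffOn hsub
  refine ContDiffOn.prodMk (f := fun q => ((prolong X).trans a b q).1)
    (g := fun q => ((prolong X).trans a b q).2) ?_ (contDiffOn_pi.2 fun J => ?_)
  · exact hlow.fst.congr fun q hq => congrArg Prod.fst (jetProj_trans h q hq)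
  · rcases J.exists_incl_or_snoc with ⟨I, rfl⟩ | ⟨I, i, rfl, -⟩
    · exact ((contDiff_apply ℝ ℝ I).comp_contDiffOn hlow.snd).congr fun q hq =>
        congrFun (congrArg Prod.snd (jetProj_trans h q hq)) I
    · have hinv : ContDiffOn ℝ ∞ (fun q => (planeTrans X a b q).inverse)
          ((prolong X).image a ((prolong X).source b)) := by
        intro q hq
        have hq2 := hq
        rw [image_source_prolong h] at hq2
        obtain ⟨-, e, he⟩ := hq2
        have h1 : ContDiffAt ℝ ∞ ContinuousLinearMap.inverse (planeTrans X a b q) := by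
          rw [← he]
          exact contDiffAt_map_inverse e
        exact h1.comp_contDiffWithinAt q ((contDiffOn_planeTrans h a b).mono hsub q hq)
      have hd : ContDiffOn ℝ ∞ (fun q => fderiv ℝ (X.trans a b) (jetProj n (k + 1) q))
          ((prolong X).image a ((prolong X).source b)) :=
        (ContDiffOn.fderiv_of_isOpen (h.contDiffOn_trans a b) (h.isOpen_image a b)
          (m := ∞) (by simp)).comp contDiff_jetProj.contDiffOn hsub
      have hall := hd.clm_apply ((contDiff_planeMap.contDiffOn).clm_apply
        (hinv.clm_apply (contDiffOn_const (c := (Pi.single i 1 : Fin n → ℝ)))))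
      exact ((contDiff_apply ℝ ℝ I).comp_contDiffOn hall.snd).congr fun q hq =>
        trans_prolong_snoc h hq I i

/-- On the prolongation the `θ_I` annihilate a vector iff its projection to `X` lies in the plane of
the base point, a condition that does not depend on the chart. Verticality likewise means zero
projection, and the new coordinate changes cover the old ones. -/
theorem IsContactSystem.prolong (h : IsContactSystem X) : IsContactSystem (prolong X) := by
  have hs : (ContactPDE.prolong X).IsSmooth :=
    ⟨injOn_coord_prolong h, isOpen_image_prolong h, contDiffOn_trans_prolong h⟩
  have hproj : ∀ a b y, y ∈ (ContactPDE.prolong X).source a → y ∈ (ContactPDE.prolong X).source b →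
      ∀ v, jetProj n (k + 1) (fderiv ℝ ((ContactPDE.prolong X).trans a b)
        ((ContactPDE.prolong X).coord a y) v) =
        fderiv ℝ (X.trans a b) (X.coord a (basePoint y)) (jetProj n (k + 1) v) := by
    intro a b y ha hb v
    have h1 : (fun q => jetProj n (k + 1) ((ContactPDE.prolong X).trans a b q)) =ᶠ[
        𝓝 ((ContactPDE.prolong X).coord a y)] fun q => X.trans a b (jetProj n (k + 1) q) := by
      filter_upwards [(hs.isOpen_image a b).mem_nhds (ChartSystem.coord_mem_image ha hb)]
      exact jetProj_trans h
    have h2 := ((hasFDerivAt_jetProj _).comp _ (hs.differentiableAt_trans ha hb).hasFDerivAt)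
    have h3 : HasFDerivAt (X.trans a b) (fderiv ℝ (X.trans a b) (X.coord a (basePoint y)))
        (jetProj n (k + 1) ((ContactPDE.prolong X).coord a y)) := by
      rw [jetProj_coord ha]
      exact (h.differentiableAt_trans (basePoint_mem_source ha)
        (basePoint_mem_source hb)).hasFDerivAt
    have h4 := h3.comp _ (hasFDerivAt_jetProj _)
    exact congrArg (fun f => f v) (h2.unique (h4.congr_of_eventuallyEq h1))
  refine ⟨hs, fun a b y ha hb v hv => ?_, fun _ a b y ha hb v hv => ?_⟩
  · rw [theta_eq_zero_iff] at hv ⊢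
    rw [hproj a b y ha hb]
    exact fderiv_trans_mem_jetPlane ha hb hv
  · rw [hproj a b y ha hb, hv, map_zero]

end Prolong

/-! ## The prolongations of a contact manifold -/

section ContactManifold

variable {n : ℕ} {M : Type u} [TopologicalSpace M]
  [ChartedSpace (EuclideanSpace ℝ (Fin (2 * n + 1))) M] {C : ContactStructure n M}

theorem ContactChart.contDiffOn_trans (a b : ContactChart C) :
    ContDiffOn ℝ ∞ (b.toHomeo ∘ a.toHomeo.symm) (a.toHomeo.symm.trans b.toHomeo).source := by
  rw [← contMDiffOn_iff_contDiffOn]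
  refine b.smooth.comp (a.smooth_symm.mono ?_) ?_
  · intro q hq
    exact hq.1
  · intro q hq
    exact hq.2

theorem ContactChart.theta_trans (a b : ContactChart C) {x : M} (ha : x ∈ a.toHomeo.source)
    (hb : x ∈ b.toHomeo.source) {v : Jet n 1}
    (hv : theta (MultiIndex.empty n 0) (a.toHomeo x) v = 0) :
    theta (MultiIndex.empty n 0) (b.toHomeo x)
      (fderiv ℝ (b.toHomeo ∘ a.toHomeo.symm) (a.toHomeo x) v) = 0 := by
  have hat : a.toHomeo x ∈ a.toHomeo.target := a.toHomeo.map_source ha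
  have hs : MDifferentiableAt 𝓘(ℝ, Jet n 1) (𝓡 (2 * n + 1)) a.toHomeo.symm (a.toHomeo x) :=
    (a.smooth_symm.contMDiffAt (a.toHomeo.open_target.mem_nhds hat)).mdifferentiableAt (by simp)
  have hda : MDifferentiableAt (𝓡 (2 * n + 1)) 𝓘(ℝ, Jet n 1) a.toHomeo
      (a.toHomeo.symm (a.toHomeo x)) := by
    rw [a.toHomeo.left_inv ha]
    exact (a.smooth.contMDiffAt (a.toHomeo.open_source.mem_nhds ha)).mdifferentiableAt (by simp)
  have hdb : MDifferentiableAt (𝓡 (2 * n + 1)) 𝓘(ℝ, Jet n 1) b.toHomeo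
      (a.toHomeo.symm (a.toHomeo x)) := by
    rw [a.toHomeo.left_inv ha]
    exact (b.smooth.contMDiffAt (b.toHomeo.open_source.mem_nhds hb)).mdifferentiableAt (by simp)
  -- Pulled back to `M`, the vector lies in the contact distribution, which both charts describe as
  -- the kernel of their form.
  set w : TangentSpace (𝓡 (2 * n + 1)) (a.toHomeo.symm (a.toHomeo x)) :=
    mfderiv 𝓘(ℝ, Jet n 1) (𝓡 (2 * n + 1)) a.toHomeo.symm (a.toHomeo x) v with hw
  have h1 : mfderiv (𝓡 (2 * n + 1)) 𝓘(ℝ, Jet n 1) a.toHomeo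
      (a.toHomeo.symm (a.toHomeo x)) w = v := by
    have := mfderiv_comp (a.toHomeo x) hda hs
    have hid : (a.toHomeo ∘ a.toHomeo.symm) =ᶠ[𝓝 (a.toHomeo x)] id := by
      filter_upwards [a.toHomeo.open_target.mem_nhds hat] with q hq
      exact a.toHomeo.right_inv hq
    rw [hid.mfderiv_eq, mfderiv_id] at this
    exact (congrArg (fun f => f v) this).symm
  have h2 : mfderiv (𝓡 (2 * n + 1)) 𝓘(ℝ, Jet n 1) b.toHomeo
      (a.toHomeo.symm (a.toHomeo x)) w =
      fderiv ℝ (b.toHomeo ∘ a.toHomeo.symm) (a.toHomeo x) v := by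
    have := mfderiv_comp (a.toHomeo x) hdb hs
    rw [mfderiv_eq_fderiv] at this
    exact (congrArg (fun f => f v) this).symm
  have hx := a.toHomeo.left_inv ha
  have h3 := a.contact (a.toHomeo.symm (a.toHomeo x)) (by rwa [hx]) w
  have h4 := b.contact (a.toHomeo.symm (a.toHomeo x)) (by rwa [hx]) w
  rw [h1] at h3
  rw [h2] at h4
  have h5 := h4.1 (h3.2 (by rw [hx]; exact hv))
  rw [hx] at h5
  exact h5

theorem isContactSystem_prolongation_zero (C : ContactStructure n M) :
    IsContactSystem (prolongation C 0) := by
  have himage : ∀ a b : ContactChart C, (prolongation C 0).image a ((prolongation C 0).source b) =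
      (a.toHomeo.symm.trans b.toHomeo).source := by
    intro a b
    ext q
    constructor
    · rintro ⟨x, ⟨hb, ha⟩, rfl⟩
      exact ⟨a.toHomeo.map_source ha, by
        change a.toHomeo.symm (a.toHomeo x) ∈ b.toHomeo.source
        rw [a.toHomeo.left_inv ha]; exact hb⟩
    · rintro ⟨h1, h2⟩
      exact ⟨a.toHomeo.symm q, ⟨h2, a.toHomeo.map_target h1⟩, a.toHomeo.right_inv h1⟩
  have hinj : ∀ a : ContactChart C,
      InjOn ((prolongation C 0).coord a) ((prolongation C 0).source a) := fun a => a.toHomeo.injOn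
  have htrans : ∀ a b : ContactChart C, ∀ q ∈ (a.toHomeo.symm.trans b.toHomeo).source,
      (prolongation C 0).trans a b q = (b.toHomeo ∘ a.toHomeo.symm) q := by
    intro a b q hq
    rw [← himage] at hq
    obtain ⟨x, ⟨hb, ha⟩, rfl⟩ := hq
    rw [ChartSystem.trans_coord (hinj a) ha hb]
    exact congrArg b.toHomeo (a.toHomeo.left_inv ha).symm
  have hs : (prolongation C 0).IsSmooth := by
    refine ⟨hinj, fun a b => ?_, fun a b => ?_⟩
    · rw [himage]
      exact (a.toHomeo.symm.trans b.toHomeo).open_source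
    · rw [himage]
      exact (a.contDiffOn_trans b).congr (htrans a b)
  refine ⟨hs, fun a b x ha hb v hv I => ?_, fun h => absurd h (by norm_num)⟩
  have hI : I = MultiIndex.empty n 0 :=
    Subtype.ext (Multiset.card_eq_zero.1 (Nat.le_zero.1 I.2))
  subst hI
  have hx : a.toHomeo x ∈ (a.toHomeo.symm.trans b.toHomeo).source := by
    rw [← himage]
    exact ChartSystem.coord_mem_image (X := prolongation C 0) ha hb
  have heq : (prolongation C 0).trans a b =ᶠ[𝓝 (a.toHomeo x)] b.toHomeo ∘ a.toHomeo.symm := by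
    filter_upwards [(a.toHomeo.symm.trans b.toHomeo).open_source.mem_nhds hx]
    exact htrans a b
  change theta _ (b.toHomeo x) (fderiv ℝ ((prolongation C 0).trans a b) (a.toHomeo x) v) = 0
  rw [heq.fderiv_eq]
  exact a.theta_trans b ha hb (hv _)

theorem isContactSystem_prolongation (C : ContactStructure n M) (k : ℕ) :
    IsContactSystem (prolongation C k) := by
  induction k with
  | zero => exact isContactSystem_prolongation_zero C
  | succ k ih => exact ih.prolong

end ContactManifold

/-! ## Homogeneous multi-indices -/

/-- Multi-indices of length exactly `k`. -/
abbrev HomIndex (n k : ℕ) : Type := {I : Multiset (Fin n) // I.card = k}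

instance (n k : ℕ) : Fintype (HomIndex n k) := inferInstanceAs (Fintype (Sym (Fin n) k))

/-! ## Total derivatives -/

section TotalDerivative

variable {n k : ℕ}

/-- The linear part of `q ↦ totalVector q i`. -/
def shift (i : Fin n) : Jet n (k + 1) →L[ℝ] Jet n k :=
  LinearMap.toContinuousLinearMap
    { toFun := fun q => (0, fun I => q.2 (I.snoc i))
      map_add' := fun _ _ => Prod.ext (by simp) rfl
      map_smul' := fun _ _ => Prod.ext (by simp) rfl }

theorem shift_apply (i : Fin n) (q : Jet n (k + 1)) :
    shift i q = (0, fun I => q.2 (I.snoc i)) := rfl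

theorem totalVector_add (q u : Jet n (k + 1)) (i : Fin n) :
    totalVector (q + u) i = totalVector q i + shift i u :=
  Prod.ext (by simp [shift_apply]) (funext fun I => by simp [shift_apply])

theorem hasFDerivAt_totalVector (q : Jet n (k + 1)) (i : Fin n) :
    HasFDerivAt (fun q : Jet n (k + 1) => totalVector q i) (shift i) q := by
  have h : (fun q : Jet n (k + 1) => totalVector q i) = fun q => totalVector 0 i + shift i q :=
    funext fun q => by rw [← totalVector_add, zero_add]
  rw [h]
  exact (shift i).hasFDerivAt.const_add _

/-- The total derivative `D_i G`. -/
def totalD (i : Fin n) (G : Jet n k → ℝ) (q : Jet n (k + 1)) : ℝ :=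
  fderiv ℝ G (jetProj n k q) (totalVector q i)

theorem totalD_congr {i : Fin n} {G G' : Jet n k → ℝ} {U : Set (Jet n k)} (hU : IsOpen U)
    (h : EqOn G G' U) : EqOn (totalD i G) (totalD i G') (jetProj n k ⁻¹' U) := by
  intro q hq
  rw [totalD, totalD, (h.eventuallyEq_of_mem (hU.mem_nhds hq)).fderiv_eq]

theorem contDiffOn_totalD {i : Fin n} {G : Jet n k → ℝ} {U : Set (Jet n k)} (hU : IsOpen U)
    (h : ContDiffOn ℝ ∞ G U) : ContDiffOn ℝ ∞ (totalD i G) (jetProj n k ⁻¹' U) :=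
  ((h.fderiv_of_isOpen hU (m := ∞) (by simp)).comp contDiff_jetProj.contDiffOn
    fun _ hq => hq).clm_apply (contDiff_totalVector i).contDiffOn

theorem hasFDerivAt_fderiv_of_mem {V : Type*} [NormedAddCommGroup V] [NormedSpace ℝ V] {G : V → ℝ}
    {U : Set V} (hU : IsOpen U) (h : ContDiffOn ℝ ∞ G U) {p : V} (hp : p ∈ U) :
    HasFDerivAt (fderiv ℝ G) (fderiv ℝ (fderiv ℝ G) p) p :=
  (((h.contDiffAt (hU.mem_nhds hp)).fderiv_right (m := ∞) (by simp)).differentiableAt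
    (by simp)).hasFDerivAt

theorem fderiv_totalD {i : Fin n} {G : Jet n k → ℝ} {U : Set (Jet n k)} (hU : IsOpen U)
    (h : ContDiffOn ℝ ∞ G U) {q : Jet n (k + 1)} (hq : jetProj n k q ∈ U) (u : Jet n (k + 1)) :
    fderiv ℝ (totalD i G) q u =
      fderiv ℝ (fderiv ℝ G) (jetProj n k q) (jetProj n k u) (totalVector q i) +
        fderiv ℝ G (jetProj n k q) (shift i u) := by
  have h1 : HasFDerivAt (fun q => fderiv ℝ G (jetProj n k q))
      ((fderiv ℝ (fderiv ℝ G) (jetProj n k q)).comp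
        (LinearMap.toContinuousLinearMap (jetProj n k))) q :=
    (hasFDerivAt_fderiv_of_mem hU h hq).comp q (hasFDerivAt_jetProj q)
  have h2 := h1.clm_apply (hasFDerivAt_totalVector q i)
  change fderiv ℝ (fun q => fderiv ℝ G (jetProj n k q) (totalVector q i)) q u = _
  rw [h2.fderiv]
  exact add_comm _ _

/-- Both terms of `fderiv_totalD` are symmetric: the first is a second derivative of `G`, the second
involves only `p_{I,i,j} = p_{I,j,i}`. -/
theorem totalD_comm {i j : Fin n} {G : Jet n k → ℝ} {U : Set (Jet n k)} (hU : IsOpen U)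
    (h : ContDiffOn ℝ ∞ G U) {q : Jet n (k + 2)}
    (hq : jetProj n k (jetProj n (k + 1) q) ∈ U) :
    totalD i (totalD j G) q = totalD j (totalD i G) q := by
  rw [totalD, totalD, fderiv_totalD hU h hq, fderiv_totalD hU h hq, jetProj_totalVector,
    jetProj_totalVector]
  have hs : shift j (totalVector q i) = shift i (totalVector q j) :=
    Prod.ext rfl (funext fun I => congrArg q.2 (I.snoc_comm j i))
  have hsymm := ((h.contDiffAt (hU.mem_nhds hq)).isSymmSndFDerivAt (by
    rw [minSmoothness_of_isRCLikeNormedField]; exact WithTop.coe_le_coe.2 (le_top : (2 : ℕ∞) ≤ ⊤)))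
      (totalVector (jetProj n (k + 1) q) i) (totalVector (jetProj n (k + 1) q) j)
  rw [hs, hsymm]

/-- The top coordinates enter a total derivative only through `totalVector`, hence affinely, even
when `G` is nonlinear. -/
theorem totalD_add_vertical (i : Fin n) (G : Jet n k → ℝ) (q : Jet n (k + 1)) {u : Jet n (k + 1)}
    (hu : jetProj n k u = 0) :
    totalD i G (q + u) = totalD i G q + fderiv ℝ G (jetProj n k q) (shift i u) := by
  rw [totalD, totalD, map_add, hu, add_zero, totalVector_add, map_add]

/-! ## The total derivatives of a second order equation -/

/-- The projection to the second order jets. -/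
def baseProj : (k : ℕ) → Jet n (k + 2) → Jet n 2
  | 0 => id
  | k + 1 => fun q => baseProj k (jetProj n (k + 2) q)

theorem contDiff_baseProj (k : ℕ) : ContDiff ℝ ∞ (baseProj (n := n) k) := by
  induction k with
  | zero => exact contDiff_id
  | succ k ih => exact ih.comp contDiff_jetProj

theorem isOpen_baseProj_preimage {U : Set (Jet n 2)} (hU : IsOpen U) (k : ℕ) :
    IsOpen (baseProj k ⁻¹' U) := hU.preimage (contDiff_baseProj k).continuous

/-- The iterated total derivative `D_J F`, `|J| = k`. -/
def totalFamily (F : Jet n 2 → ℝ) : (k : ℕ) → Multiset (Fin n) → Jet n (k + 2) → ℝ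
  | 0, _ => F
  | k + 1, J => open Classical in
    if h : ∃ i, i ∈ J then totalD h.choose (totalFamily F k (J.erase h.choose)) else 0

variable {F : Jet n 2 → ℝ} {U : Set (Jet n 2)}

theorem contDiffOn_totalFamily (hU : IsOpen U) (hF : ContDiffOn ℝ ∞ F U) (k : ℕ)
    (J : Multiset (Fin n)) : ContDiffOn ℝ ∞ (totalFamily F k J) (baseProj k ⁻¹' U) := by
  induction k generalizing J with
  | zero => exact hF
  | succ k ih =>
    unfold totalFamily
    split_ifs with h
    · exact contDiffOn_totalD (isOpen_baseProj_preimage hU k) (ih _)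
    · exact contDiffOn_const

/-- The definition of `totalFamily` peels off an arbitrarily chosen index; commutation of total
derivatives shows that any other choice gives the same function. -/
theorem totalFamily_cons (hU : IsOpen U) (hF : ContDiffOn ℝ ∞ F U) (k : ℕ)
    {J : Multiset (Fin n)} (hJ : J.card = k) (i : Fin n) :
    EqOn (totalFamily F (k + 1) (i ::ₘ J)) (totalD i (totalFamily F k J))
      (baseProj (k + 1) ⁻¹' U) := by
  classical
  induction k generalizing J i with
  | zero =>
    intro q _
    have h : ∃ j, j ∈ i ::ₘ J := ⟨i, Multiset.mem_cons_self i J⟩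
    have hi : h.choose = i := by
      refine (Multiset.mem_cons.1 h.choose_spec).resolve_right ?_
      simp [Multiset.card_eq_zero.1 hJ]
    change (if h : ∃ j, j ∈ i ::ₘ J then totalD h.choose F else 0) q = totalD i F q
    rw [dif_pos h, hi]
  | succ k ih =>
    intro q hq
    have h : ∃ j, j ∈ i ::ₘ J := ⟨i, Multiset.mem_cons_self i J⟩
    rw [totalFamily, dif_pos h]
    suffices H : ∀ j ∈ i ::ₘ J, totalD j (totalFamily F (k + 1) ((i ::ₘ J).erase j)) q =
        totalD i (totalFamily F (k + 1) J) q by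
      convert H _ h.choose_spec
    intro j hj
    by_cases hji : j = i
    · subst hji
      rw [Multiset.erase_cons_head]
    · have hjJ : j ∈ J := (Multiset.mem_cons.1 hj).resolve_left hji
      -- By induction the two sides become `D_j D_i` and `D_i D_j` of `D_H F`.
      obtain ⟨H, rfl⟩ := Multiset.exists_cons_of_mem hjJ
      have hH : H.card = k := by simpa using hJ
      rw [Multiset.erase_cons_tail _ (Ne.symm hji), Multiset.erase_cons_head,
        totalD_congr (isOpen_baseProj_preimage hU (k + 1)) (ih hH i) hq,
        totalD_congr (isOpen_baseProj_preimage hU (k + 1)) (ih hH j) hq]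
      exact totalD_comm (isOpen_baseProj_preimage hU k) (contDiffOn_totalFamily hU hF k H) hq

/-! ## The symbol -/

/-- The multi-index `J, I`. -/
def MultiIndex.append (J : HomIndex n k) (I : HomIndex n 2) : MultiIndex n (k + 2) :=
  ⟨J.1 + I.1, by rw [Multiset.card_add, J.2, I.2]⟩

/-- The coordinate vector `∂_{p_I}`, `|I| = 2`. -/
def secondVector (I : HomIndex n 2) : Jet n 2 := (0, Pi.single ⟨I.1, I.2.le⟩ 1)

/-- The derivatives `∂F/∂p_I`, `|I| = 2`. -/
def symbol (F : Jet n 2 → ℝ) (p : Jet n 2) (I : HomIndex n 2) : ℝ :=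
  fderiv ℝ F p (secondVector I)

theorem eq_sum_secondVector {u : Jet n 2} (hu : jetProj n 1 u = 0) :
    u = ∑ I : HomIndex n 2, u.2 ⟨I.1, I.2.le⟩ • secondVector I := by
  refine Prod.ext ?_ (funext fun K => ?_)
  · rw [Prod.fst_sum]
    simpa [secondVector] using (congrArg Prod.fst hu :)
  · rw [Prod.snd_sum, Finset.sum_apply]
    simp only [secondVector, Prod.smul_snd, Pi.smul_apply, smul_eq_mul]
    by_cases hK : K.1.card ≤ 1
    · have h0 : u.2 K = 0 := congrFun (congrArg Prod.snd hu :) (⟨K.1, hK⟩ : MultiIndex n 1)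
      rw [h0]
      refine (Finset.sum_eq_zero fun I _ => ?_).symm
      have hne : K ≠ (⟨I.1, I.2.le⟩ : MultiIndex n 2) := by
        rintro rfl
        have := I.2
        simp only at hK
        omega
      rw [Pi.single_eq_of_ne hne, mul_zero]
    · have hK2 : K.1.card = 2 := le_antisymm K.2 (by omega)
      rw [Finset.sum_eq_single (⟨K.1, hK2⟩ : HomIndex n 2)]
      · simp
      · intro I _ hI
        have hne : K ≠ (⟨I.1, I.2.le⟩ : MultiIndex n 2) := by
          rintro rfl
          exact hI rfl
        rw [Pi.single_eq_of_ne hne, mul_zero]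
      · simp

theorem fderiv_eq_sum_symbol (F : Jet n 2 → ℝ) (p : Jet n 2) {u : Jet n 2}
    (hu : jetProj n 1 u = 0) :
    fderiv ℝ F p u = ∑ I : HomIndex n 2, symbol F p I * u.2 ⟨I.1, I.2.le⟩ := by
  conv_lhs => rw [eq_sum_secondVector hu, map_sum]
  exact Finset.sum_congr rfl fun I _ => by rw [map_smul, smul_eq_mul, mul_comm]; rfl

/-- The two claims feed each other: the vertical derivative of `D_H F` gives exact affineness of
`D_i D_H F` in the next top coordinates, and affineness gives its vertical derivative. `F` itself
may be nonlinear in the `p_ij`, so affineness needs `0 < k`. -/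
theorem totalFamily_vertical (hU : IsOpen U) (hF : ContDiffOn ℝ ∞ F U) (k : ℕ)
    (J : HomIndex n k) {p w : Jet n (k + 2)} (hp : baseProj k p ∈ U)
    (hw : jetProj n (k + 1) w = 0) :
    fderiv ℝ (totalFamily F k J.1) p w =
        ∑ I, symbol F (baseProj k p) I * w.2 (MultiIndex.append J I) ∧
      (0 < k → totalFamily F k J.1 (p + w) = totalFamily F k J.1 p +
        ∑ I, symbol F (baseProj k p) I * w.2 (MultiIndex.append J I)) := by
  induction k with
  | zero =>
    refine ⟨?_, fun h => absurd h (lt_irrefl 0)⟩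
    have hJ : J.1 = 0 := Multiset.card_eq_zero.1 J.2
    simp only [totalFamily, baseProj, id]
    rw [fderiv_eq_sum_symbol F p hw]
    refine Finset.sum_congr rfl fun I _ => ?_
    refine congrArg (symbol F p I * ·) (congrArg w.2 (Subtype.ext ?_))
    change I.1 = J.1 + I.1
    rw [hJ, zero_add]
  | succ k ih =>
    have haff : ∀ w : Jet n (k + 3), jetProj n (k + 2) w = 0 →
        totalFamily F (k + 1) J.1 (p + w) = totalFamily F (k + 1) J.1 p +
          ∑ I, symbol F (baseProj (k + 1) p) I * w.2 (MultiIndex.append J I) := by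
      intro w hw
      obtain ⟨i, H, hH⟩ : ∃ i H, i ::ₘ H = J.1 ∧ H.card = k := by
        obtain ⟨i, hi⟩ := Multiset.card_pos_iff_exists_mem.1 (by rw [J.2]; exact k.succ_pos : 0 < J.1.card)
        obtain ⟨H, hH⟩ := Multiset.exists_cons_of_mem hi
        exact ⟨i, H, hH.symm, by simpa [hH] using J.2⟩
      have hpw : baseProj (k + 1) (p + w) ∈ U := by
        change baseProj k (jetProj n (k + 2) (p + w)) ∈ U
        rw [map_add, hw, add_zero]
        exact hp
      have hshift : jetProj n (k + 1) (shift i w) = 0 :=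
        Prod.ext rfl (funext fun I => congrFun (congrArg Prod.snd hw :) (I.snoc i))
      have h1 := (ih ⟨H, hH.2⟩ (p := jetProj n (k + 2) p) hp hshift).1
      rw [← hH.1, totalFamily_cons hU hF k hH.2 i hpw, totalFamily_cons hU hF k hH.2 i hp,
        totalD_add_vertical i _ p hw]
      refine congrArg (totalD i (totalFamily F k H) p + ·) (h1.trans ?_)
      refine Finset.sum_congr rfl fun I _ => ?_
      refine congrArg (symbol F (baseProj (k + 1) p) I * ·) (congrArg w.2 (Subtype.ext ?_))
      change i ::ₘ (H + I.1) = J.1 + I.1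
      rw [← hH.1, Multiset.cons_add]
    refine ⟨?_, fun _ => haff w hw⟩
    have hline : HasDerivAt (fun t : ℝ => p + t • w) w 0 := by
      simpa using ((hasDerivAt_id (0 : ℝ)).smul_const w).const_add p
    have hd : HasFDerivAt (totalFamily F (k + 1) J.1) (fderiv ℝ (totalFamily F (k + 1) J.1) p)
        (p + (0 : ℝ) • w) := by
      rw [zero_smul, add_zero]
      exact (((contDiffOn_totalFamily hU hF (k + 1) J.1).contDiffAt
        ((isOpen_baseProj_preimage hU (k + 1)).mem_nhds hp)).differentiableAt
          (by simp)).hasFDerivAt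
    have h1 := hd.comp_hasDerivAt (0 : ℝ) hline
    have h2 : totalFamily F (k + 1) J.1 ∘ (fun t : ℝ => p + t • w) = fun t =>
        totalFamily F (k + 1) J.1 p +
          t * ∑ I, symbol F (baseProj (k + 1) p) I * w.2 (MultiIndex.append J I) := by
      funext t
      simp only [Function.comp]
      rw [haff (t • w) (by rw [map_smul, hw, smul_zero]), Finset.mul_sum]
      refine congrArg _ (Finset.sum_congr rfl fun I _ => ?_)
      simp only [Prod.smul_snd, Pi.smul_apply, smul_eq_mul]
      ring
    rw [h2] at h1
    have h3 := ((hasDerivAt_id (0 : ℝ)).mul_const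
      (∑ I, symbol F (baseProj (k + 1) p) I * w.2 (MultiIndex.append J I))).const_add
        (totalFamily F (k + 1) J.1 p)
    simpa using h1.unique h3

/-- The symbol of the equations `D_J F = 0`, `|J| = k`. -/
def symbolMap (k : ℕ) (c : HomIndex n 2 → ℝ) :
    (HomIndex n (k + 2) → ℝ) →L[ℝ] (HomIndex n k → ℝ) :=
  ContinuousLinearMap.pi fun J => ∑ I, c I •
    ContinuousLinearMap.proj (R := ℝ) (φ := fun _ : HomIndex n (k + 2) => ℝ)
      ⟨J.1 + I.1, by rw [Multiset.card_add, J.2, I.2]⟩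

theorem symbolMap_apply (k : ℕ) (c : HomIndex n 2 → ℝ) (z : HomIndex n (k + 2) → ℝ)
    (J : HomIndex n k) :
    symbolMap k c z J = ∑ I : HomIndex n 2, c I * z ⟨J.1 + I.1, by
      rw [Multiset.card_add, J.2, I.2]⟩ := by
  simp only [symbolMap, ContinuousLinearMap.coe_pi', sum_apply]
  rfl

/-- If the range were proper, a nonzero functional `f` would vanish on it. Regarded as a form of
degree `k`, `f` would have zero product with the nonzero quadratic form `c`, which is impossible in
a domain. -/
theorem symbolMap_surjective (k : ℕ) {c : HomIndex n 2 → ℝ} (hc : c ≠ 0) :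
    Function.Surjective (symbolMap k c) := by
  classical
  rw [← ContinuousLinearMap.coe_coe, ← LinearMap.range_eq_top]
  by_contra hne
  obtain ⟨f, hf, hle⟩ := Submodule.exists_le_ker_of_lt_top _ (lt_top_iff_ne_top.2 hne)
  let poly : ∀ {l : ℕ}, (HomIndex n l → ℝ) → MvPolynomial (Fin n) ℝ := fun d =>
    ∑ I, MvPolynomial.monomial (Multiset.toFinsupp I.1) (d I)
  have hpoly : ∀ {l : ℕ} (d : HomIndex n l → ℝ), poly d = 0 → d = 0 := by
    intro l d h
    funext K
    have := congrArg (MvPolynomial.coeff (Multiset.toFinsupp K.1)) h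
    simp only [poly, MvPolynomial.coeff_sum, MvPolynomial.coeff_monomial,
      EmbeddingLike.apply_eq_iff_eq, MvPolynomial.coeff_zero] at this
    rw [Finset.sum_eq_single K] at this
    · simpa using this
    · intro I _ hI
      rw [if_neg fun h => hI (Subtype.ext h)]
    · simp
  have hfz : ∀ z, f z = ∑ J, f (Pi.single J 1) * z J := by
    intro z
    conv_lhs => rw [pi_eq_sum_univ' z, map_sum]
    refine Finset.sum_congr rfl fun J _ => ?_
    rw [map_smul, smul_eq_mul, mul_comm]
  have hmul : poly c * poly (fun J : HomIndex n k => f (Pi.single J 1)) = 0 := by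
    ext m
    simp only [poly, Finset.sum_mul_sum, MvPolynomial.monomial_mul, MvPolynomial.coeff_sum,
      MvPolynomial.coeff_monomial, MvPolynomial.coeff_zero]
    -- Evaluating `f ∘ symbolMap` on the indicator of `m` yields the coefficient of `m` in the
    -- product; for `m` of degree other than `k + 2` the indicator is zero, as is the coefficient.
    have h0 : f (symbolMap k c fun K => if Multiset.toFinsupp K.1 = m then 1 else 0) = 0 :=
      hle ⟨_, rfl⟩
    rw [hfz] at h0
    rw [Finset.sum_comm]
    refine Eq.trans ?_ h0
    refine Finset.sum_congr rfl fun J _ => ?_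
    rw [symbolMap_apply, Finset.mul_sum]
    refine Finset.sum_congr rfl fun I _ => ?_
    simp only [map_add]
    rw [add_comm (Multiset.toFinsupp J.1)]
    split_ifs <;> ring
  rcases mul_eq_zero.1 hmul with h | h
  · exact hc (hpoly _ h)
  · refine hf (LinearMap.ext fun z => ?_)
    rw [hfz]
    have := hpoly _ h
    simp [fun J => congrFun this J]

end TotalDerivative

/-! ## Hypersurfaces -/

section Hypersurface

variable {V : Type} [NormedAddCommGroup V] [NormedSpace ℝ V] [FiniteDimensional ℝ V]

theorem isOpen_fderiv_mem_range {f : V → V} {U : Set V} (hU : IsOpen U)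
    (hf : ContDiffOn ℝ ∞ f U) :
    IsOpen (U ∩ fderiv ℝ f ⁻¹' range ((↑) : (V ≃L[ℝ] V) → V →L[ℝ] V)) :=
  (hf.continuousOn_fderiv_of_isOpen hU (by simp)).isOpen_inter_preimage hU
    ContinuousLinearEquiv.isOpen

/-- A regular function is linear in suitable coordinates. -/
theorem exists_straightening {U : Set V} (hU : IsOpen U) {F : V → ℝ} (hF : ContDiffOn ℝ ∞ F U)
    {p : V} (hp : p ∈ U) (hd : fderiv ℝ F p ≠ 0) :
    ∃ φ : OpenPartialHomeomorph V V, p ∈ φ.source ∧ φ.source ⊆ U ∧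
      ContDiffOn ℝ ∞ φ φ.source ∧ ContDiffOn ℝ ∞ φ.symm φ.target ∧
      HasFDerivAt φ (ContinuousLinearMap.id ℝ V) p ∧ ∀ y ∈ φ.source, F y = fderiv ℝ F p (φ y) := by
  have : CompleteSpace V := FiniteDimensional.complete ℝ V
  set L := fderiv ℝ F p with hL
  obtain ⟨w, hw⟩ : ∃ w, L w = 1 := by
    obtain ⟨w, hw⟩ : ∃ w, L w ≠ 0 := by
      by_contra! h
      exact hd (ContinuousLinearMap.ext h)
    exact ⟨(L w)⁻¹ • w, by rw [map_smul, smul_eq_mul, inv_mul_cancel₀ hw]⟩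
  -- Correcting the identity along `w`, where `L w = 1`, gives `L ∘ f = F`, and the correction has
  -- zero derivative at `p`.
  let f : V → V := fun y => y + (F y - L y) • w
  have hf : ContDiffOn ℝ ∞ f U :=
    contDiffOn_id.add ((hF.sub L.contDiff.contDiffOn).smul contDiffOn_const)
  have hfp : HasFDerivAt f ((ContinuousLinearEquiv.refl ℝ V : V ≃L[ℝ] V) : V →L[ℝ] V) p := by
    have h1 : HasFDerivAt F L p :=
      ((hF.contDiffAt (hU.mem_nhds hp)).differentiableAt (by simp)).hasFDerivAt
    have h2 := (hasFDerivAt_id p).add ((h1.sub L.hasFDerivAt).smul_const w)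
    rw [sub_self, ContinuousLinearMap.zero_smulRight, add_zero] at h2
    exact h2
  have hLf : ∀ y, L (f y) = F y := fun y => by
    simp only [f, map_add, map_smul, hw, smul_eq_mul]
    ring
  have hfc : ContDiffAt ℝ ∞ f p := hf.contDiffAt (hU.mem_nhds hp)
  have hopen := isOpen_fderiv_mem_range hU hf
  -- The restriction to points with invertible derivative makes the inverse smooth on the whole
  -- target.
  let φ := (hfc.toOpenPartialHomeomorph f hfp (by simp)).restrOpen _ hopen
  have hφ : (φ : V → V) = f := rfl
  have hsrc : φ.source ⊆ U ∩ fderiv ℝ f ⁻¹' range ((↑) : (V ≃L[ℝ] V) → V →L[ℝ] V) := by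
    rw [OpenPartialHomeomorph.restrOpen_source]
    exact inter_subset_right
  refine ⟨φ, ?_, fun y hy => (hsrc hy).1, ?_, ?_, ?_, ?_⟩
  · rw [OpenPartialHomeomorph.restrOpen_source]
    exact ⟨hfc.mem_toOpenPartialHomeomorph_source hfp (by simp), hp, _, hfp.fderiv.symm⟩
  · rw [hφ]
    exact hf.mono fun y hy => (hsrc hy).1
  · intro y hy
    obtain ⟨h1, e, he⟩ := hsrc (φ.map_target hy)
    have h2 : ContDiffAt ℝ ∞ f (φ.symm y) := hf.contDiffAt (hU.mem_nhds h1)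
    have h3 : HasFDerivAt f (e : V →L[ℝ] V) (φ.symm y) := by
      rw [he]
      exact (h2.differentiableAt (by simp)).hasFDerivAt
    exact (φ.contDiffAt_symm hy h3 h2).contDiffWithinAt
  · rw [hφ]
    exact hfp
  · intro y _
    rw [hφ, hLf]

theorem finrank_ker_of_ne_zero {L : V →L[ℝ] ℝ} (hL : L ≠ 0) :
    Module.finrank ℝ (LinearMap.ker L.toLinearMap) = Module.finrank ℝ V - 1 := by
  have h1 := LinearMap.finrank_range_add_finrank_ker L.toLinearMap
  have h2 : LinearMap.range L.toLinearMap = ⊤ := by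
    refine LinearMap.range_eq_top.2 (LinearMap.surjective fun h => hL ?_)
    exact ContinuousLinearMap.ext fun v => congrArg (fun f => f v) h
  rw [h2, finrank_top, Module.finrank_self] at h1
  omega

theorem exists_hypersurface_chart {S U : Set V} (hU : IsOpen U) {F : V → ℝ}
    (hF : ContDiffOn ℝ ∞ F U) (hS : ∀ p ∈ U, p ∈ S ↔ F p = 0) {p : V} (hp : p ∈ U)
    (hd : fderiv ℝ F p ≠ 0) :
    ∃ (φ : OpenPartialHomeomorph V V) (W : Submodule ℝ V),
      p ∈ φ.source ∧ ContDiffOn ℝ ∞ φ φ.source ∧ ContDiffOn ℝ ∞ φ.symm φ.target ∧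
      Module.finrank ℝ W = Module.finrank ℝ V - 1 ∧ ∀ y ∈ φ.source, y ∈ S ↔ φ y ∈ W := by
  obtain ⟨φ, h1, h2, h3, h4, -, h6⟩ := exists_straightening hU hF hp hd
  refine ⟨φ, LinearMap.ker (fderiv ℝ F p).toLinearMap, h1, h3, h4, finrank_ker_of_ne_zero hd,
    fun y hy => ?_⟩
  rw [hS y (h2 hy), h6 y hy]
  rfl

/-- In straightened coordinates a line in the direction `v` stays in the hypersurface. The
straightening has identity derivative at `p`, so the image curve still has velocity `v`. -/
theorem hasVelocity_hypersurface {S U : Set V} (hU : IsOpen U) {F : V → ℝ}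
    (hF : ContDiffOn ℝ ∞ F U) (hS : ∀ p ∈ U, p ∈ S ↔ F p = 0) {p v : V} (hp : p ∈ U)
    (hpS : p ∈ S) (hd : fderiv ℝ F p ≠ 0) (hv : fderiv ℝ F p v = 0) : HasVelocity S p v := by
  obtain ⟨φ, h1, h2, h3, h4, h5, h6⟩ := exists_straightening hU hF hp hd
  have hline : HasVelocity {w | fderiv ℝ F p w = 0} (φ p) v := by
    refine ⟨fun t => φ p + t • v, by fun_prop, by simp, ?_, Eventually.of_forall fun t => ?_⟩
    · simpa using ((hasDerivAt_id (0 : ℝ)).smul_const v).const_add (φ p)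
    · change fderiv ℝ F p (φ p + t • v) = 0
      rw [map_add, map_smul, hv, ← h6 p h1, (hS p hp).1 hpS]
      simp
  have h7 := hline.map (S' := S) φ.open_target (φ.map_source h1) h4 (by
    rintro y ⟨hy, hyt⟩
    have hs := φ.map_target hyt
    rw [hS _ (h2 hs), h6 _ hs, φ.right_inv hyt]
    exact hy)
  have h8 : HasFDerivAt φ.symm (((ContinuousLinearEquiv.refl ℝ V).symm : V ≃L[ℝ] V) : V →L[ℝ] V)
      (φ p) :=
    φ.hasFDerivAt_symm (f' := ContinuousLinearEquiv.refl ℝ V) (φ.map_source h1)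
      (by rw [φ.left_inv h1]; exact h5)
  rw [φ.left_inv h1, h8.fderiv] at h7
  exact h7

end Hypersurface

/-! ## Affine equations for the top order coordinates -/

section Affine

variable {n m : ℕ}

/-- The coordinates `p_I` with `|I| = m + 1`. -/
def topPart (n m : ℕ) : Jet n (m + 1) →L[ℝ] (HomIndex n (m + 1) → ℝ) :=
  LinearMap.toContinuousLinearMap
    { toFun := fun q I => q.2 ⟨I.1, I.2.le⟩
      map_add' := fun _ _ => rfl
      map_smul' := fun _ _ => rfl }

theorem topPart_apply (q : Jet n (m + 1)) (I : HomIndex n (m + 1)) :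
    topPart n m q I = q.2 ⟨I.1, I.2.le⟩ := rfl

/-- Splitting off the coordinates of top order. -/
def jetSplit (n m : ℕ) : Jet n (m + 1) ≃L[ℝ] Jet n m × (HomIndex n (m + 1) → ℝ) :=
  LinearEquiv.toContinuousLinearEquiv
    { toFun := fun q => (jetProj n m q, topPart n m q)
      map_add' := fun _ _ => by rw [map_add, map_add]; rfl
      map_smul' := fun _ _ => by rw [map_smul, map_smul]; rfl
      invFun := fun r => (r.1.1, fun I =>
        if h : I.1.card ≤ m then r.1.2 ⟨I.1, h⟩ else r.2 ⟨I.1, le_antisymm I.2 (by omega)⟩)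
      left_inv := fun q => Prod.ext rfl (funext fun I => by
        by_cases h : I.1.card ≤ m
        · simp only [dif_pos h]; rfl
        · simp only [dif_neg h]; rfl)
      right_inv := fun r => by
        refine Prod.ext (Prod.ext rfl (funext fun I => ?_)) (funext fun I => ?_)
        · have h : I.incl.1.card ≤ m := I.2
          simp only [jetProj_snd, dif_pos h]
          rfl
        · have h : ¬ I.1.card ≤ m := by rw [I.2]; omega
          simp only [topPart_apply, dif_neg h] }

theorem jetProj_jetSplit_symm (r : Jet n m × (HomIndex n (m + 1) → ℝ)) :
    jetProj n m ((jetSplit n m).symm r) = r.1 :=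
  congrArg Prod.fst ((jetSplit n m).apply_symm_apply r :)

theorem topPart_jetSplit_symm (r : Jet n m × (HomIndex n (m + 1) → ℝ)) :
    topPart n m ((jetSplit n m).symm r) = r.2 :=
  congrArg Prod.snd ((jetSplit n m).apply_symm_apply r :)

theorem jetSplit_symm_eq (q : Jet n (m + 1)) :
    (jetSplit n m).symm (jetProj n m q, topPart n m q) = q :=
  (jetSplit n m).symm_apply_apply q

variable {Y : Type} [NormedAddCommGroup Y] [NormedSpace ℝ Y] {d : ℕ}

/-- Over `U` the map `H` is affine in the coordinates of top order, with surjective linear part `A`,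
and `R` is a smooth family of inverses of `z ↦ (A z, B z)`. -/
structure AffineTriv (d : ℕ) (U : Set (Jet n m)) (H : Jet n (m + 1) → Y) where
  /-- The linear part. -/
  A : Jet n m → (HomIndex n (m + 1) → ℝ) →L[ℝ] Y
  /-- The inhomogeneous part. -/
  l : Jet n m → Y
  /-- Complementary coordinates. -/
  B : (HomIndex n (m + 1) → ℝ) →L[ℝ] EuclideanSpace ℝ (Fin d)
  /-- The inverse. -/
  R : Jet n m → Y × EuclideanSpace ℝ (Fin d) →L[ℝ] (HomIndex n (m + 1) → ℝ)
  isOpen : IsOpen U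
  eq : ∀ q, jetProj n m q ∈ U → H q = A (jetProj n m q) (topPart n m q) + l (jetProj n m q)
  smooth_A : ContDiffOn ℝ ∞ A U
  smooth_l : ContDiffOn ℝ ∞ l U
  smooth_R : ContDiffOn ℝ ∞ R U
  R_apply : ∀ p ∈ U, ∀ z, R p (A p z, B z) = z
  A_R : ∀ p ∈ U, ∀ y f, A p (R p (y, f)) = y
  B_R : ∀ p ∈ U, ∀ y f, B (R p (y, f)) = f

/-- `B` is a linear projection onto the kernel of `A`, followed by coordinates on this kernel. -/
theorem exists_complement [FiniteDimensional ℝ Y] {Z : Type} [NormedAddCommGroup Z]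
    [NormedSpace ℝ Z] [FiniteDimensional ℝ Z] {A : Z →L[ℝ] Y} (hA : Function.Surjective A)
    (hd : d = Module.finrank ℝ Z - Module.finrank ℝ Y) :
    ∃ (B : Z →L[ℝ] EuclideanSpace ℝ (Fin d)) (e : Z ≃L[ℝ] Y × EuclideanSpace ℝ (Fin d)),
      (e : Z →L[ℝ] Y × EuclideanSpace ℝ (Fin d)) = A.prod B := by
  have h1 := LinearMap.finrank_range_add_finrank_ker A.toLinearMap
  rw [LinearMap.range_eq_top.2 hA, finrank_top] at h1
  have hK : Module.finrank ℝ (LinearMap.ker A.toLinearMap) =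
      Module.finrank ℝ (EuclideanSpace ℝ (Fin d)) := by
    rw [finrank_euclideanSpace_fin]
    omega
  let ε := LinearEquiv.ofFinrankEq _ _ hK
  obtain ⟨g, hg⟩ := LinearMap.exists_leftInverse_of_injective
    (LinearMap.ker A.toLinearMap).subtype (by simp)
  let B : Z →ₗ[ℝ] EuclideanSpace ℝ (Fin d) := ε.toLinearMap ∘ₗ g
  have hinj : Function.Injective (A.toLinearMap.prod B) := by
    refine (injective_iff_map_eq_zero _).2 fun z hz => ?_
    have hz1 : z ∈ LinearMap.ker A.toLinearMap := congrArg Prod.fst hz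
    have hz2 : ε (g z) = 0 := congrArg Prod.snd hz
    have hz3 : g z = ⟨z, hz1⟩ := congrArg (fun f => f ⟨z, hz1⟩) hg
    rw [hz3, LinearEquiv.map_eq_zero_iff] at hz2
    exact congrArg Subtype.val hz2
  have hrank : Module.finrank ℝ Z = Module.finrank ℝ (Y × EuclideanSpace ℝ (Fin d)) := by
    rw [Module.finrank_prod, ← hK, h1]
  exact ⟨LinearMap.toContinuousLinearMap B,
    (LinearEquiv.ofInjectiveOfFinrankEq _ hinj hrank).toContinuousLinearEquiv,
    ContinuousLinearMap.ext fun z => rfl⟩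

/-- A map that is affine in the coordinates of top order, with surjective linear part at `p`, can
be trivialized near `p`. -/
theorem exists_affineTriv [FiniteDimensional ℝ Y] {U : Set (Jet n m)} (hU : IsOpen U)
    {H : Jet n (m + 1) → Y} {A : Jet n m → (HomIndex n (m + 1) → ℝ) →L[ℝ] Y} {l : Jet n m → Y}
    (hH : ∀ q, jetProj n m q ∈ U → H q = A (jetProj n m q) (topPart n m q) + l (jetProj n m q))
    (hA : ContDiffOn ℝ ∞ A U) (hl : ContDiffOn ℝ ∞ l U) {p : Jet n m} (hp : p ∈ U)
    (hs : Function.Surjective (A p))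
    (hd : d = Module.finrank ℝ (HomIndex n (m + 1) → ℝ) - Module.finrank ℝ Y) :
    ∃ U' ⊆ U, p ∈ U' ∧ Nonempty (AffineTriv d U' H) := by
  obtain ⟨B, e, he⟩ := exists_complement hs hd
  let P : Jet n m → (HomIndex n (m + 1) → ℝ) →L[ℝ] Y × EuclideanSpace ℝ (Fin d) :=
    fun p => (A p).prod B
  have hP : ContDiffOn ℝ ∞ P U := by
    have : P = fun p => (ContinuousLinearMap.inl ℝ Y (EuclideanSpace ℝ (Fin d))).comp (A p) +
        (ContinuousLinearMap.inr ℝ Y (EuclideanSpace ℝ (Fin d))).comp B :=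
      funext fun p => ContinuousLinearMap.ext fun z => Prod.ext (by simp [P]) (by simp [P])
    rw [this]
    exact (contDiffOn_const.clm_comp hA).add contDiffOn_const
  -- `B` is fixed once and for all at `p`; the pair `(A, B)` remains invertible at nearby points.
  have hopen : IsOpen (U ∩ P ⁻¹' range ((↑) : ((HomIndex n (m + 1) → ℝ) ≃L[ℝ]
      Y × EuclideanSpace ℝ (Fin d)) → _)) :=
    hP.continuousOn.isOpen_inter_preimage hU ContinuousLinearEquiv.isOpen
  refine ⟨U ∩ P ⁻¹' range (↑), inter_subset_left, ⟨hp, e, he⟩, ⟨{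
    A := A
    l := l
    B := B
    R := fun p => (P p).inverse
    isOpen := hopen
    eq := fun q hq => hH q hq.1
    smooth_A := hA.mono inter_subset_left
    smooth_l := hl.mono inter_subset_left
    smooth_R := ?_
    R_apply := ?_
    A_R := ?_
    B_R := ?_ }⟩⟩
  · rintro p ⟨hp, e, he⟩
    have h1 : ContDiffAt ℝ ∞ ContinuousLinearMap.inverse (P p) := by
      rw [← he]
      exact contDiffAt_map_inverse e
    exact h1.comp_contDiffWithinAt p ((hP.mono inter_subset_left) p ⟨hp, e, he⟩)
  · rintro p ⟨hp, e, he⟩ z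
    have h1 : (A p z, B z) = e z := congrArg (fun f => f z) he.symm
    rw [← he, ContinuousLinearMap.inverse_equiv, h1]
    exact e.symm_apply_apply z
  · rintro p ⟨hp, e, he⟩ y f
    have h1 : e (e.symm (y, f)) = (A p (e.symm (y, f)), B (e.symm (y, f))) :=
      congrArg (fun g => g (e.symm (y, f))) he
    rw [← he, ContinuousLinearMap.inverse_equiv]
    rw [e.apply_symm_apply] at h1
    exact (congrArg Prod.fst h1).symm
  · rintro p ⟨hp, e, he⟩ y f
    have h1 : e (e.symm (y, f)) = (A p (e.symm (y, f)), B (e.symm (y, f))) :=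
      congrArg (fun g => g (e.symm (y, f))) he
    rw [← he, ContinuousLinearMap.inverse_equiv]
    rw [e.apply_symm_apply] at h1
    exact (congrArg Prod.snd h1).symm

namespace AffineTriv

variable {U : Set (Jet n m)} {H : Jet n (m + 1) → Y}

/-- The solution of `H = 0` over `p` with parameter `f`. -/
def sol (T : AffineTriv d U H) (p : Jet n m) (f : EuclideanSpace ℝ (Fin d)) : Jet n (m + 1) :=
  (jetSplit n m).symm (p, T.R p (-T.l p, f))

theorem jetProj_sol (T : AffineTriv d U H) (p : Jet n m) (f : EuclideanSpace ℝ (Fin d)) :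
    jetProj n m (T.sol p f) = p := jetProj_jetSplit_symm _

theorem B_sol (T : AffineTriv d U H) {p : Jet n m} (hp : p ∈ U) (f : EuclideanSpace ℝ (Fin d)) :
    T.B (topPart n m (T.sol p f)) = f := by
  rw [sol, topPart_jetSplit_symm, T.B_R p hp]

theorem H_sol (T : AffineTriv d U H) {p : Jet n m} (hp : p ∈ U) (f : EuclideanSpace ℝ (Fin d)) :
    H (T.sol p f) = 0 := by
  rw [T.eq _ (by rwa [jetProj_sol]), jetProj_sol, sol, topPart_jetSplit_symm, T.A_R p hp,
    neg_add_cancel]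

theorem sol_eq (T : AffineTriv d U H) {q : Jet n (m + 1)} (hq : jetProj n m q ∈ U) (h : H q = 0) :
    T.sol (jetProj n m q) (T.B (topPart n m q)) = q := by
  have h1 : -T.l (jetProj n m q) = T.A (jetProj n m q) (topPart n m q) := by
    rw [neg_eq_iff_add_eq_zero, add_comm, ← T.eq q hq, h]
  rw [sol, h1, T.R_apply _ hq, jetSplit_symm_eq]

theorem contDiffOn_sol (T : AffineTriv d U H) :
    ContDiffOn ℝ ∞ (fun r : Jet n m × EuclideanSpace ℝ (Fin d) => T.sol r.1 r.2)
      (U ×ˢ univ) := by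
  have hfst : MapsTo (Prod.fst : Jet n m × EuclideanSpace ℝ (Fin d) → Jet n m) (U ×ˢ univ) U :=
    fun r hr => hr.1
  refine (jetSplit n m).symm.contDiff.comp_contDiffOn (contDiffOn_fst.prodMk ?_)
  exact (T.smooth_R.comp contDiffOn_fst hfst).clm_apply
    (((T.smooth_l.comp contDiffOn_fst hfst).neg).prodMk contDiffOn_snd)

theorem contDiffOn_H (T : AffineTriv d U H) : ContDiffOn ℝ ∞ H (jetProj n m ⁻¹' U) := by
  have hm : MapsTo (jetProj n m) (jetProj n m ⁻¹' U) U := fun _ h => h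
  refine ContDiffOn.congr ?_ T.eq
  exact ((T.smooth_A.comp contDiff_jetProj.contDiffOn hm).clm_apply
    (topPart n m).contDiff.contDiffOn).add (T.smooth_l.comp contDiff_jetProj.contDiffOn hm)

theorem isOpen_preimage (T : AffineTriv d U H) : IsOpen (jetProj n m ⁻¹' U) := T.isOpen.preimage continuous_jetProj

theorem fderiv_H_vertical (T : AffineTriv d U H) {q w : Jet n (m + 1)} (hq : jetProj n m q ∈ U)
    (hw : jetProj n m w = 0) : fderiv ℝ H q w = T.A (jetProj n m q) (topPart n m w) := by
  have hline : HasDerivAt (fun t : ℝ => q + t • w) w 0 := by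
    simpa using ((hasDerivAt_id (0 : ℝ)).smul_const w).const_add q
  have hd : HasFDerivAt H (fderiv ℝ H q) (q + (0 : ℝ) • w) := by
    rw [zero_smul, add_zero]
    exact ((T.contDiffOn_H.contDiffAt (T.isOpen_preimage.mem_nhds hq)).differentiableAt
      (by simp)).hasFDerivAt
  have h1 := hd.comp_hasDerivAt (0 : ℝ) hline
  have h2 : H ∘ (fun t : ℝ => q + t • w) = fun t =>
      H q + t • T.A (jetProj n m q) (topPart n m w) := by
    funext t
    have hp : jetProj n m (q + t • w) = jetProj n m q := by
      rw [map_add, map_smul, hw, smul_zero, add_zero]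
    simp only [Function.comp]
    rw [T.eq _ (by rwa [hp]), T.eq _ hq, hp, map_add, map_add, map_smul, map_smul]
    abel
  rw [h2] at h1
  have h3 := ((hasDerivAt_id (0 : ℝ)).smul_const
    (T.A (jetProj n m q) (topPart n m w))).const_add (H q)
  simpa using h1.unique h3

variable {S : Set (Jet n m)} {S' : Set (Jet n (m + 1))}

/-- Curves in the base lift to solutions. -/
theorem hasVelocity_lift (T : AffineTriv d U H)
    (hS : ∀ q, jetProj n m q ∈ U → (q ∈ S' ↔ jetProj n m q ∈ S ∧ H q = 0))
    {q v : Jet n (m + 1)} (hq : jetProj n m q ∈ U) (hq' : q ∈ S')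
    (hv : HasVelocity S (jetProj n m q) (jetProj n m v)) (hH : fderiv ℝ H q v = 0) :
    HasVelocity S' q v := by
  obtain ⟨γ, h1, h2, h3, h4⟩ := hv.exists_mem (T.isOpen.mem_nhds hq)
  -- The fibre parameter moves linearly, with the initial value and velocity dictated by `q` and
  -- `v`.
  let f : ℝ → EuclideanSpace ℝ (Fin d) := fun t =>
    T.B (topPart n m q) + t • T.B (topPart n m v)
  let c : ℝ → Jet n (m + 1) := fun t => T.sol (γ t) (f t)
  have hHq : H q = 0 := ((hS q hq).1 hq').2
  have hc0 : c 0 = q := by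
    simp only [c, f, h2, zero_smul, add_zero]
    exact T.sol_eq hq hHq
  have hcs : ContDiff ℝ ∞ c := by
    have hf : ContDiff ℝ ∞ f := by fun_prop
    refine contDiff_iff_contDiffAt.2 fun t => ?_
    exact (T.contDiffOn_sol.contDiffAt ((T.isOpen.prod isOpen_univ).mem_nhds
      ⟨(h4 t).2, mem_univ _⟩)).comp t (h1.prodMk hf).contDiffAt (f := fun t => (γ t, f t))
  have hcS : ∀ t, c t ∈ S' := fun t => by
    have hp : jetProj n m (c t) = γ t := T.jetProj_sol _ _
    rw [hS _ (by rw [hp]; exact (h4 t).2), hp]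
    exact ⟨(h4 t).1, T.H_sol (h4 t).2 _⟩
  have hcd : HasDerivAt c (deriv c 0) 0 := (hcs.differentiable (by simp) 0).hasDerivAt
  have e1 : jetProj n m (deriv c 0) = jetProj n m v := by
    have h5 := (hasFDerivAt_jetProj (c 0)).comp_hasDerivAt (0 : ℝ) hcd
    have h6 : jetProj n m ∘ c = γ := funext fun t => T.jetProj_sol _ _
    rw [h6] at h5
    exact h5.unique h3
  have e2 : T.B (topPart n m (deriv c 0)) = T.B (topPart n m v) := by
    have h5 := (T.B.comp (topPart n m)).hasFDerivAt.comp_hasDerivAt (0 : ℝ) hcd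
    have h6 : (T.B.comp (topPart n m)) ∘ c = f := funext fun t => T.B_sol (h4 t).2 _
    rw [h6] at h5
    have h7 : HasDerivAt f (T.B (topPart n m v)) 0 := by
      have h8 := ((hasDerivAt_id (0 : ℝ)).smul_const (T.B (topPart n m v))).const_add
        (T.B (topPart n m q))
      rw [one_smul] at h8
      exact h8
    exact h5.unique h7
  have e3 : fderiv ℝ H q (deriv c 0) = 0 := by
    have hd : HasFDerivAt H (fderiv ℝ H q) (c 0) := by
      rw [hc0]
      exact ((T.contDiffOn_H.contDiffAt (T.isOpen_preimage.mem_nhds hq)).differentiableAt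
        (by simp)).hasFDerivAt
    have h5 := hd.comp_hasDerivAt (0 : ℝ) hcd
    have h6 : H ∘ c = fun _ => 0 := funext fun t => T.H_sol (h4 t).2 _
    rw [h6] at h5
    exact h5.unique (hasDerivAt_const _ _)
  -- The difference of the velocities is vertical, and both `A` (by `e3` and `hH`) and `B` (by `e2`)
  -- kill its top part, so it vanishes.
  have hw : jetProj n m (deriv c 0 - v) = 0 := by rw [map_sub, e1, sub_self]
  have h7 := T.fderiv_H_vertical hq hw
  rw [map_sub, e3, hH, sub_self] at h7
  have h8 := T.R_apply _ hq (topPart n m (deriv c 0 - v))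
  rw [← h7, map_sub, map_sub, e2, sub_self, ← map_sub] at h8
  have h9 : deriv c 0 = v := by
    have := jetSplit_symm_eq (deriv c 0 - v)
    rw [hw, ← h8] at this
    rw [← sub_eq_zero, ← this, show ((0 : Y), (0 : EuclideanSpace ℝ (Fin d))) = 0 from rfl,
      map_zero]
    exact map_zero (jetSplit n m).symm
  exact ⟨c, hcs, hc0, h9 ▸ hcd, Eventually.of_forall hcS⟩

/-- A straightening of the base induces one of the solutions. -/
theorem exists_submanifold_chart [FiniteDimensional ℝ Y] (T : AffineTriv d U H)
    (hS : ∀ q, jetProj n m q ∈ U → (q ∈ S' ↔ jetProj n m q ∈ S ∧ H q = 0))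
    {r : ℕ} (hr : IsSubmanifoldOfDim S r) {q : Jet n (m + 1)} (hq : jetProj n m q ∈ U)
    (hqS : jetProj n m q ∈ S) :
    ∃ (φ : OpenPartialHomeomorph (Jet n (m + 1)) (Jet n (m + 1)))
      (W : Submodule ℝ (Jet n (m + 1))),
      q ∈ φ.source ∧ ContDiffOn ℝ ∞ φ φ.source ∧ ContDiffOn ℝ ∞ φ.symm φ.target ∧
      Module.finrank ℝ W = r + d ∧ ∀ y ∈ φ.source, y ∈ S' ↔ φ y ∈ W := by
  obtain ⟨φ, W, hφq, hφ, hφs, hW, hφS⟩ := hr _ hqS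
  set p := jetProj n m q with hp
  let e : (HomIndex n (m + 1) → ℝ) ≃ₗ[ℝ] Y × EuclideanSpace ℝ (Fin d) :=
    { toFun := fun z => (T.A p z, T.B z)
      map_add' := fun _ _ => by rw [map_add, map_add]; rfl
      map_smul' := fun _ _ => by rw [map_smul, map_smul]; rfl
      invFun := T.R p
      left_inv := T.R_apply p hq
      right_inv := fun r => Prod.ext (T.A_R p hq _ _) (T.B_R p hq _ _) }
  -- The base is straightened by `φ`, and every fibre is carried to the fixed fibre over `p` so that
  -- `H` becomes the linear map `T.A p`. The image of `S'` is then the linear slice `W × ker (T.A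
  -- p)`.
  let Φ : Jet n (m + 1) → Jet n (m + 1) := fun q => (jetSplit n m).symm
    (φ (jetProj n m q), T.R p (H q, T.B (topPart n m q)))
  let Φ' : Jet n (m + 1) → Jet n (m + 1) := fun q => (jetSplit n m).symm
    (φ.symm (jetProj n m q), T.R (φ.symm (jetProj n m q))
      (T.A p (topPart n m q) - T.l (φ.symm (jetProj n m q)), T.B (topPart n m q)))
  have hΦ1 : ∀ q, jetProj n m (Φ q) = φ (jetProj n m q) := fun q => jetProj_jetSplit_symm _
  have hΦ2 : ∀ q, topPart n m (Φ q) = T.R p (H q, T.B (topPart n m q)) := fun q =>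
    topPart_jetSplit_symm _
  have hΦ'1 : ∀ q, jetProj n m (Φ' q) = φ.symm (jetProj n m q) := fun q =>
    jetProj_jetSplit_symm _
  have hΦ'2 : ∀ q, topPart n m (Φ' q) = T.R (φ.symm (jetProj n m q))
      (T.A p (topPart n m q) - T.l (φ.symm (jetProj n m q)), T.B (topPart n m q)) := fun q =>
    topPart_jetSplit_symm _
  have hsm : ContDiffOn ℝ ∞ Φ (jetProj n m ⁻¹' (φ.source ∩ U)) := by
    refine (jetSplit n m).symm.contDiff.comp_contDiffOn (ContDiffOn.prodMk ?_ ?_)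
    · exact hφ.comp contDiff_jetProj.contDiffOn fun q hq => hq.1
    · refine (T.R p).contDiff.comp_contDiffOn (ContDiffOn.prodMk ?_ ?_)
      · exact T.contDiffOn_H.mono fun q hq => hq.2
      · exact (T.B.comp (topPart n m)).contDiff.contDiffOn
  have hsm' : ContDiffOn ℝ ∞ Φ' (jetProj n m ⁻¹' (φ.target ∩ φ.symm ⁻¹' U)) := by
    have h1 : ContDiffOn ℝ ∞ (fun q => φ.symm (jetProj n m q))
        (jetProj n m ⁻¹' (φ.target ∩ φ.symm ⁻¹' U)) :=
      hφs.comp contDiff_jetProj.contDiffOn fun q hq => hq.1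
    have h2 : MapsTo (fun q => φ.symm (jetProj n m q))
        (jetProj n m ⁻¹' (φ.target ∩ φ.symm ⁻¹' U)) U := fun q hq => hq.2
    refine (jetSplit n m).symm.contDiff.comp_contDiffOn (ContDiffOn.prodMk h1 ?_)
    refine (T.smooth_R.comp h1 h2).clm_apply (ContDiffOn.prodMk ?_ ?_)
    · exact (((T.A p).comp (topPart n m)).contDiff.contDiffOn).sub (T.smooth_l.comp h1 h2)
    · exact (T.B.comp (topPart n m)).contDiff.contDiffOn
  let ψ : OpenPartialHomeomorph (Jet n (m + 1)) (Jet n (m + 1)) :=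
    { toFun := Φ
      invFun := Φ'
      source := jetProj n m ⁻¹' (φ.source ∩ U)
      target := jetProj n m ⁻¹' (φ.target ∩ φ.symm ⁻¹' U)
      map_source' := by
        rintro q ⟨h1, h2⟩
        refine ⟨?_, ?_⟩
        · rw [hΦ1]; exact φ.map_source h1
        · rw [mem_preimage, hΦ1, φ.left_inv h1]; exact h2
      map_target' := by
        rintro q ⟨h1, h2⟩
        refine ⟨?_, ?_⟩
        · rw [hΦ'1]; exact φ.map_target h1
        · rw [hΦ'1]; exact h2
      left_inv' := by
        rintro q ⟨h1, h2⟩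
        rw [← jetSplit_symm_eq (Φ' (Φ q)), hΦ'1, hΦ'2, hΦ1, hΦ2, φ.left_inv h1,
          T.A_R p hq, T.B_R p hq, T.eq q h2, add_sub_cancel_right,
          T.R_apply _ h2, jetSplit_symm_eq]
      right_inv' := by
        rintro q ⟨h1, h2⟩
        have h3 : H (Φ' q) = T.A p (topPart n m q) := by
          rw [T.eq _ (by rw [hΦ'1]; exact h2), hΦ'1, hΦ'2, T.A_R _ h2, sub_add_cancel]
        rw [← jetSplit_symm_eq (Φ (Φ' q)), hΦ1, hΦ2, hΦ'1, hΦ'2, h3, T.B_R _ h2,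
          T.R_apply p hq, φ.right_inv h1, jetSplit_symm_eq]
      open_source := (φ.open_source.inter T.isOpen).preimage continuous_jetProj
      open_target := (φ.isOpen_inter_preimage_symm T.isOpen).preimage continuous_jetProj
      continuousOn_toFun := hsm.continuousOn
      continuousOn_invFun := hsm'.continuousOn }
  let K : Submodule ℝ (HomIndex n (m + 1) → ℝ) := LinearMap.ker (T.A p).toLinearMap
  have hK : Module.finrank ℝ K = d := by
    have h1 := LinearMap.finrank_range_add_finrank_ker (T.A p).toLinearMap
    have h2 : LinearMap.range (T.A p).toLinearMap = ⊤ :=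
      LinearMap.range_eq_top.2 fun y => ⟨T.R p (y, 0), T.A_R p hq y 0⟩
    have h3 := e.finrank_eq
    rw [h2, finrank_top] at h1
    rw [Module.finrank_prod, finrank_euclideanSpace_fin, ← h1] at h3
    exact Nat.add_left_cancel h3
  refine ⟨ψ, (W.prod K).comap (jetSplit n m).toLinearEquiv.toLinearMap, ⟨hφq, hq⟩, hsm, hsm', ?_,
    ?_⟩
  · have hr : W.prod K = LinearMap.range (W.subtype.prodMap K.subtype) := by
      rw [LinearMap.range_prodMap, Submodule.range_subtype, Submodule.range_subtype]
    have hi : Function.Injective (W.subtype.prodMap K.subtype) :=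
      Function.Injective.prodMap Subtype.val_injective Subtype.val_injective
    rw [Submodule.comap_equiv_eq_map_symm, LinearEquiv.finrank_map_eq, hr,
      LinearMap.finrank_range_of_inj hi, Module.finrank_prod, hW, hK]
  · rintro y ⟨h1, h2⟩
    rw [hS y h2, hφS _ h1]
    change _ ↔ jetProj n m (Φ y) ∈ W ∧ T.A p (topPart n m (Φ y)) = 0
    rw [hΦ1, hΦ2, T.A_R p hq]

end AffineTriv

end Affine

/-! ## Prolongations of a second order equation in coordinates -/

section Equation

variable {n : ℕ} {M : Type u} [TopologicalSpace M]
  [ChartedSpace (EuclideanSpace ℝ (Fin (2 * n + 1))) M] {C : ContactStructure n M}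
  {E : Set (prolongation C 1).carrier} {a : ContactChart C}

/-- The coordinate image of `E⁽ᵏ⁾` in a chart. -/
def jetImage (E : Set (prolongation C 1).carrier) (a : ContactChart C) (k : ℕ) :
    Set (Jet n (k + 2)) :=
  (prolongation C (k + 1)).image a (prolongedEquation E k)

/-- `F = 0` is an equation of `E` in the coordinates of the chart `a`, on the open set `U`, and the
derivatives `∂F/∂p_I`, `|I| = 2`, do not vanish simultaneously. -/
structure IsEquation (E : Set (prolongation C 1).carrier) (a : ContactChart C) (U : Set (Jet n 2))
    (F : Jet n 2 → ℝ) : Prop where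
  isOpen : IsOpen U
  smooth : ContDiffOn ℝ ∞ F U
  mem_iff : ∀ p ∈ U, p ∈ jetImage E a 0 ↔ F p = 0
  symbol_ne_zero : ∀ p ∈ U, symbol F p ≠ 0

theorem symbol_ne_zero_of_fderiv {F : Jet n 2 → ℝ} {p u : Jet n 2} (hu : jetProj n 1 u = 0)
    (h : fderiv ℝ F p u ≠ 0) : symbol F p ≠ 0 := by
  intro h0
  apply h
  rw [fderiv_eq_sum_symbol F p hu, h0]
  simp

theorem contDiffOn_symbol {U : Set (Jet n 2)} (hU : IsOpen U) {F : Jet n 2 → ℝ}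
    (hF : ContDiffOn ℝ ∞ F U) : ContDiffOn ℝ ∞ (symbol F) U :=
  contDiffOn_pi.2 fun _ => (hF.fderiv_of_isOpen hU (m := ∞) (by simp)).clm_apply contDiffOn_const

/-- Near each of its points, a second order equation with nonvanishing conformal metric has an
equation with nonvanishing symbol in each contact chart. -/
theorem exists_isEquation {e : (prolongation C 1).carrier}
    (hg : ConformalMetricNeZero E e) (ha : e ∈ (prolongation C 1).source a) :
    ∃ U F, IsEquation E a U F ∧ (prolongation C 1).coord a e ∈ U := by
  obtain ⟨Q, hQ⟩ := hg
  have hX := isContactSystem_prolongation C 1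
  set b := Q.chart
  have hb : e ∈ (prolongation C 1).source b := Q.mem_source
  let F : Jet n 2 → ℝ := fun p => Q.F ((prolongation C 1).trans a b p)
  have hopen : IsOpen ((prolongation C 1).image a ((prolongation C 1).source b) ∩ (prolongation C 1).trans a b ⁻¹' Q.U) :=
    (hX.contDiffOn_trans a b).continuousOn.isOpen_inter_preimage (hX.isOpen_image a b) Q.isOpen
  have hF : ContDiffOn ℝ ∞ F ((prolongation C 1).image a ((prolongation C 1).source b) ∩ (prolongation C 1).trans a b ⁻¹' Q.U) :=
    Q.smooth.comp ((hX.contDiffOn_trans a b).mono inter_subset_left) fun p hp => hp.2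
  have hmem : (prolongation C 1).coord a e ∈ (prolongation C 1).image a ((prolongation C 1).source b) ∩ (prolongation C 1).trans a b ⁻¹' Q.U := by
    refine ⟨ChartSystem.coord_mem_image ha hb, ?_⟩
    rw [mem_preimage, hX.trans_coord ha hb]
    exact Q.coord_mem
  have hs : symbol F ((prolongation C 1).coord a e) ≠ 0 := by
    obtain ⟨i, j, hij⟩ : ∃ i j, metricMatrix Q.F ((prolongation C 1).coord b e) i j ≠ 0 := by
      by_contra! h
      exact hQ (Matrix.ext h)
    have hij' : fderiv ℝ Q.F ((prolongation C 1).coord b e) (0, Pi.single (MultiIndex.pair i j) 1) ≠ 0 :=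
      right_ne_zero_of_mul hij
    have hvert : jetProj n 1 ((0, Pi.single (MultiIndex.pair i j) 1) : Jet n 2) = 0 := by
      refine Prod.ext rfl (funext fun I => ?_)
      refine Pi.single_eq_of_ne (fun h => ?_) _
      have h1 : I.1 = {i, j} := congrArg Subtype.val h
      have h2 := I.2
      rw [h1] at h2
      simp at h2
    -- The vector `∂_{p_ij}` of the chart `b`, transported to the chart `a`, remains vertical, and
    -- the differential of the equation takes the same nonzero value on it. Nonvanishing of the
    -- symbol is thus independent of the chart.
    refine symbol_ne_zero_of_fderiv (hX.vertical le_rfl b a e hb ha _ hvert) ?_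
    have h1 : HasFDerivAt Q.F (fderiv ℝ Q.F ((prolongation C 1).coord b e)) ((prolongation C 1).trans a b ((prolongation C 1).coord a e)) := by
      rw [hX.trans_coord ha hb]
      exact ((Q.smooth.contDiffAt (Q.isOpen.mem_nhds Q.coord_mem)).differentiableAt
        (by simp)).hasFDerivAt
    have h2 : HasFDerivAt F _ ((prolongation C 1).coord a e) :=
      h1.comp _ (hX.differentiableAt_trans ha hb).hasFDerivAt
    rw [h2.fderiv]
    change fderiv ℝ Q.F ((prolongation C 1).coord b e) (fderiv ℝ ((prolongation C 1).trans a b) ((prolongation C 1).coord a e) _) ≠ 0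
    rw [hX.fderiv_trans_symm hb ha]
    exact hij'
  -- The symbol is nonzero at `e`; the domain is shrunk to keep it nonzero throughout.
  have hsopen := (contDiffOn_symbol hopen hF).continuousOn.isOpen_inter_preimage hopen
    (isOpen_compl_singleton (x := (0 : HomIndex n 2 → ℝ)))
  refine ⟨_, F, ⟨hsopen, hF.mono inter_subset_left, ?_, fun p hp => hp.2⟩, hmem, hs⟩
  rintro _ ⟨⟨⟨x, ⟨hxb, hxa⟩, rfl⟩, hU⟩, -⟩
  rw [mem_preimage, hX.trans_coord hxa hxb] at hU
  change (prolongation C 1).coord a x ∈ (prolongation C 1).image a E ↔ Q.F ((prolongation C 1).trans a b ((prolongation C 1).coord a x)) = 0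
  rw [hX.coord_mem_image_iff hxa, hX.trans_coord hxa hxb]
  exact Q.mem_iff x hxb hU

/-- The equations `D_J F`, `|J| = k + 1`. -/
def topEquations (F : Jet n 2 → ℝ) (k : ℕ) (q : Jet n (k + 3)) : HomIndex n (k + 1) → ℝ :=
  fun J => totalFamily F (k + 1) J.1 q

/-- The dimension of the fibres of `E⁽ᵏ⁺¹⁾ → E⁽ᵏ⁾`. -/
def fibreDim (n k : ℕ) : ℕ :=
  Module.finrank ℝ (HomIndex n (k + 2 + 1) → ℝ) - Module.finrank ℝ (HomIndex n (k + 1) → ℝ)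

variable {U : Set (Jet n 2)} {F : Jet n 2 → ℝ}

/-- The linear part is `symbolMap` of the symbol at the underlying second order jet, surjective
because that symbol is nonzero; the inhomogeneous part is the value at zero top coordinates. -/
theorem IsEquation.exists_affineTriv (h : IsEquation E a U F) (k : ℕ) {p : Jet n (k + 2)}
    (hp : baseProj k p ∈ U) : ∃ U' ⊆ baseProj k ⁻¹' U, p ∈ U' ∧
      Nonempty (AffineTriv (m := k + 2) (fibreDim n k) U' (topEquations F k)) := by
  have hsym : ContDiffOn ℝ ∞ (fun p => symbol F (baseProj k p)) (baseProj k ⁻¹' U) :=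
    (contDiffOn_symbol h.isOpen h.smooth).comp (contDiff_baseProj k).contDiffOn fun _ hp => hp
  have hzero : ContDiff ℝ ∞ fun p : Jet n (k + 2) => (jetSplit n (k + 2)).symm (p, 0) :=
    (jetSplit n (k + 2)).symm.contDiff.comp (contDiff_id.prodMk contDiff_const)
  refine ContactPDE.exists_affineTriv (m := k + 2) (isOpen_baseProj_preimage h.isOpen k)
    (A := fun p => symbolMap (k + 1) (symbol F (baseProj k p)))
    (l := fun p => topEquations F k ((jetSplit n (k + 2)).symm (p, 0))) ?_ ?_ ?_ hp
    (symbolMap_surjective (k + 1) (h.symbol_ne_zero _ hp)) rfl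
  · intro q hq
    set q₀ := (jetSplit n (k + 2)).symm (jetProj n (k + 2) q, 0) with hq₀
    have h1 : jetProj n (k + 2) q₀ = jetProj n (k + 2) q := jetProj_jetSplit_symm _
    have h2 : topPart n (k + 2) q₀ = 0 := topPart_jetSplit_symm _
    have hw : jetProj n (k + 2) (q - q₀) = 0 := by rw [map_sub, h1, sub_self]
    have hb : baseProj (k + 1) q₀ = baseProj k (jetProj n (k + 2) q) := congrArg (baseProj k) h1
    have hU : baseProj (k + 1) q₀ ∈ U := by rw [hb]; exact hq
    funext J
    have h3 := (totalFamily_vertical h.isOpen h.smooth (k + 1) J hU hw).2 k.succ_pos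
    rw [add_sub_cancel, hb] at h3
    rw [Pi.add_apply, symbolMap_apply, add_comm]
    refine h3.trans (congrArg (totalFamily F (k + 1) J.1 q₀ + ·) ?_)
    refine Finset.sum_congr rfl fun I _ => congrArg (symbol F _ I * ·) ?_
    have h4 : topPart n (k + 2) (q - q₀) = topPart n (k + 2) q := by rw [map_sub, h2, sub_zero]
    exact congrFun h4 ⟨J.1 + I.1, by rw [Multiset.card_add, J.2, I.2]⟩
  · refine contDiffOn_clm_apply.2 fun z => contDiffOn_pi.2 fun J => ?_
    simp only [symbolMap_apply]
    exact ContDiffOn.sum fun I _ =>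
      ((contDiff_apply ℝ ℝ I).comp_contDiffOn hsym).mul contDiffOn_const
  · refine contDiffOn_pi.2 fun J => ?_
    refine (contDiffOn_totalFamily h.isOpen h.smooth (k + 1) J.1).comp hzero.contDiffOn
      fun p hp => ?_
    change baseProj k (jetProj n (k + 2) ((jetSplit n (k + 2)).symm (p, 0))) ∈ U
    rw [jetProj_jetSplit_symm]
    exact hp

theorem jetProj_mem_jetImage {k : ℕ} {q : Jet n (k + 3)} (hq : q ∈ jetImage E a (k + 1)) :
    jetProj n (k + 2) q ∈ jetImage E a k := by
  obtain ⟨y, ⟨hy, hya⟩, rfl⟩ := hq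
  have h1 := jetProj_coord (X := prolongation C (k + 1)) hya
  refine (congrArg (· ∈ jetImage E a k) h1).mpr ?_
  exact ChartSystem.coord_mem_image (basePoint_mem_source (X := prolongation C (k + 1)) hya) hy.1

/-- The plane of a point of the prolonged equation consists of velocities of curves in the
equation. -/
theorem hasVelocity_of_mem_jetPlane {k : ℕ} {q : Jet n (k + 3)} (hq : q ∈ jetImage E a (k + 1))
    {u : Jet n (k + 2)} (hu : u ∈ jetPlane q) :
    HasVelocity (jetImage E a k) (jetProj n (k + 2) q) u := by
  obtain ⟨y, ⟨hy, hya⟩, rfl⟩ := hq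
  have h1 := jetProj_coord (X := prolongation C (k + 1)) hya
  obtain ⟨v, hv, rfl⟩ := exists_mem_plane (X := prolongation C (k + 1)) hya hu
  have h2 := (hy.2 hv).2 a (basePoint_mem_source (X := prolongation C (k + 1)) hya)
  refine (congrArg (HasVelocity (jetImage E a k) · (v a)) h1).mpr ?_
  exact h2

theorem fderiv_eq_zero_of_mem_jetPlane {k : ℕ} {G : Jet n k → ℝ} {p : Jet n k}
    {q : Jet n (k + 1)} (h : ∀ i, fderiv ℝ G p (totalVector q i) = 0) {u : Jet n k}
    (hu : u ∈ jetPlane q) : fderiv ℝ G p u = 0 := by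
  have hle : jetPlane q ≤ LinearMap.ker (fderiv ℝ G p).toLinearMap := by
    rw [jetPlane, Submodule.span_le]
    rintro _ ⟨i, rfl⟩
    exact h i
  exact hle hu

/-- The equations of a prolongation, in terms of the velocities of curves in the equation. -/
theorem IsEquation.mem_jetImage_succ_iff_of (h : IsEquation E a U F) {k : ℕ}
    (hvan : ∀ p ∈ jetImage E a k, baseProj k p ∈ U →
      ∀ J : HomIndex n k, totalFamily F k J.1 p = 0)
    (hvel : ∀ q : Jet n (k + 3), baseProj (k + 1) q ∈ U → jetProj n (k + 2) q ∈ jetImage E a k →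
      (∀ (J : HomIndex n k) i,
        fderiv ℝ (totalFamily F k J.1) (jetProj n (k + 2) q) (totalVector q i) = 0) →
      ∀ u ∈ jetPlane q, HasVelocity (jetImage E a k) (jetProj n (k + 2) q) u)
    {q : Jet n (k + 3)} (hq : baseProj (k + 1) q ∈ U) :
    q ∈ jetImage E a (k + 1) ↔ jetProj n (k + 2) q ∈ jetImage E a k ∧ topEquations F k q = 0 := by
  -- The equations of order `k + 1` thus say that the differentials of the `D_J F`, `|J| = k`, kill
  -- the plane of `q`.
  have hcons : ∀ (J : HomIndex n k) i, totalFamily F (k + 1) (i ::ₘ J.1) q =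
      fderiv ℝ (totalFamily F k J.1) (jetProj n (k + 2) q) (totalVector q i) := fun J i =>
    totalFamily_cons h.isOpen h.smooth k J.2 i hq
  have hnhds : baseProj k ⁻¹' U ∈ 𝓝 (jetProj n (k + 2) q) :=
    (isOpen_baseProj_preimage h.isOpen k).mem_nhds hq
  constructor
  · intro hmem
    refine ⟨jetProj_mem_jetImage hmem, funext fun J => ?_⟩
    obtain ⟨i, hi⟩ := Multiset.card_pos_iff_exists_mem.1 (by rw [J.2]; exact k.succ_pos :
      0 < J.1.card)
    obtain ⟨H, hH⟩ := Multiset.exists_cons_of_mem hi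
    have hHc : H.card = k := by simpa [hH] using J.2
    change totalFamily F (k + 1) J.1 q = 0
    rw [hH, hcons ⟨H, hHc⟩ i]
    refine (hasVelocity_of_mem_jetPlane hmem (totalVector_mem_jetPlane q i)).fderiv_eq_zero hnhds
      ?_ fun p hp => hvan p hp.1 hp.2 ⟨H, hHc⟩
    exact ((contDiffOn_totalFamily h.isOpen h.smooth k H).contDiffAt hnhds).differentiableAt
      (by simp)
  · rintro ⟨⟨x, ⟨hx, hxa⟩, hxq⟩, heq⟩
    have hX := isContactSystem_prolongation C (k + 1)
    obtain ⟨y, rfl, hy, rfl⟩ := hX.exists_coord_eq hxa hxq.symm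
    refine ⟨y, ⟨⟨hx, fun v hv => ?_⟩, hy⟩, rfl⟩
    have hL : IsLagrangianPlane (prolongation C (k + 1)) (basePoint y) (plane y) := y.2
    refine (hX.mem_tangentTo_iff hxa (hL.le_tangentSpace hv)).2 ?_
    have h1 := hvel _ hq (hxq ▸ ChartSystem.coord_mem_image hxa hx)
      (fun J i => by
        rw [← hcons J i]
        exact congrFun heq ⟨i ::ₘ J.1, by rw [Multiset.card_cons, J.2]⟩)
      (v a) (apply_mem_jetPlane hy hv)
    exact (congrArg (HasVelocity (jetImage E a k) · (v a)) hxq).mpr h1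

theorem IsEquation.fderiv_ne_zero (h : IsEquation E a U F) {p : Jet n 2} (hp : p ∈ U) :
    fderiv ℝ F p ≠ 0 := by
  intro h0
  refine h.symbol_ne_zero p hp (funext fun I => ?_)
  simp [symbol, h0]

/-- In coordinates `E⁽ᵏ⁺¹⁾` is given, over `E⁽ᵏ⁾`, by the equations `D_J F = 0`,
`|J| = k + 1`. -/
theorem IsEquation.mem_jetImage_succ_iff (h : IsEquation E a U F) (k : ℕ) {q : Jet n (k + 3)}
    (hq : baseProj (k + 1) q ∈ U) :
    q ∈ jetImage E a (k + 1) ↔ jetProj n (k + 2) q ∈ jetImage E a k ∧ topEquations F k q = 0 := by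
  induction k with
  | zero =>
    refine h.mem_jetImage_succ_iff_of (fun p hp hpU J => (h.mem_iff p hpU).1 hp) ?_ hq
    intro q hqU hqE hd u hu
    exact hasVelocity_hypersurface h.isOpen h.smooth h.mem_iff hqU hqE (h.fderiv_ne_zero hqU)
      (fderiv_eq_zero_of_mem_jetPlane (fun i => hd ⟨0, rfl⟩ i) hu)
  | succ k ih =>
    refine h.mem_jetImage_succ_iff_of
      (fun p hp hpU J => congrFun ((ih hpU).1 hp).2 J) ?_ hq
    intro q hqU hqE hd u hu
    obtain ⟨U', hU', hp, ⟨T⟩⟩ := h.exists_affineTriv k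
      (p := jetProj n (k + 2) (jetProj n (k + 3) q)) hqU
    -- The projection of `u` lies in the plane of a point of `E⁽ᵏ⁺¹⁾`, so it is a velocity of
    -- `E⁽ᵏ⁾`. Since `u` is also killed by the differentials of the top equations, the curve lifts
    -- with velocity `u`.
    refine T.hasVelocity_lift (fun q hq => ih (hU' hq)) hp hqE ?_ ?_
    · refine hasVelocity_of_mem_jetPlane hqE ?_
      rw [mem_jetPlane_iff] at hu ⊢
      exact fun I => hu I.incl
    · have hdiff : ∀ J, DifferentiableAt ℝ (fun q => topEquations F k q J) (jetProj n (k + 3) q) :=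
        fun J => ((contDiffOn_totalFamily h.isOpen h.smooth (k + 1) J.1).contDiffAt
          ((isOpen_baseProj_preimage h.isOpen (k + 1)).mem_nhds hqU)).differentiableAt (by simp)
      funext J
      rw [fderiv_pi hdiff]
      exact fderiv_eq_zero_of_mem_jetPlane (fun i => hd J i) hu

end Equation

/-! ## Formal integrability -/

section Integrability

variable {n : ℕ} {M : Type u} [TopologicalSpace M]
  [ChartedSpace (EuclideanSpace ℝ (Fin (2 * n + 1))) M] {C : ContactStructure n M}
  {E : Set (prolongation C 1).carrier} {a : ContactChart C}

theorem exists_isEquation_of_mem_jetImage (hg : ∀ e ∈ E, ConformalMetricNeZero E e) {k : ℕ}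
    {p : Jet n (k + 2)} (hp : p ∈ jetImage E a k) :
    ∃ U F, IsEquation E a U F ∧ baseProj k p ∈ U := by
  induction k with
  | zero =>
    obtain ⟨e, ⟨he, hea⟩, rfl⟩ := hp
    exact exists_isEquation (hg e he) hea
  | succ k ih => exact ih (jetProj_mem_jetImage hp)

/-- A point of `E` comes with the contact chart of a local equation. All higher planes over this
chart lie in the induced charts, because they are horizontal. -/
theorem exists_mem_source (hg : ∀ e ∈ E, ConformalMetricNeZero E e) (k : ℕ)
    {x : (prolongation C (k + 1)).carrier} (hx : x ∈ prolongedEquation E k) :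
    ∃ a, x ∈ (prolongation C (k + 1)).source a := by
  induction k with
  | zero =>
    obtain ⟨Q, -⟩ := hg x hx
    exact ⟨Q.chart, Q.mem_source⟩
  | succ k ih =>
    obtain ⟨a, ha⟩ := ih (x := basePoint (X := prolongation C (k + 1)) x) hx.1
    exact ⟨a, (mem_source_prolong_iff (X := prolongation C (k + 1)) (Nat.le_add_left 1 k)).2 ha⟩

theorem exists_affineTriv_of_mem_jetImage (hg : ∀ e ∈ E, ConformalMetricNeZero E e) {k : ℕ}
    {p : Jet n (k + 2)} (hp : p ∈ jetImage E a k) :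
    ∃ (F : Jet n 2 → ℝ) (U : Set (Jet n (k + 2)))
      (_ : AffineTriv (m := k + 2) (fibreDim n k) U (topEquations F k)),
      p ∈ U ∧ ∀ q : Jet n (k + 3), jetProj n (k + 2) q ∈ U →
        (q ∈ jetImage E a (k + 1) ↔
          jetProj n (k + 2) q ∈ jetImage E a k ∧ topEquations F k q = 0) := by
  obtain ⟨U, F, h, hpU⟩ := exists_isEquation_of_mem_jetImage hg hp
  obtain ⟨U', hU', hp', ⟨T⟩⟩ := h.exists_affineTriv k hpU
  exact ⟨F, U', T, hp', fun q hq => h.mem_jetImage_succ_iff k (hU' hq)⟩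

/-- The dimension of `E⁽ᵏ⁾`. -/
def prolongationDim (n : ℕ) : ℕ → ℕ
  | 0 => Module.finrank ℝ (Jet n 2) - 1
  | k + 1 => prolongationDim n k + fibreDim n k

theorem isSubmanifoldOfDim_jetImage (hg : ∀ e ∈ E, ConformalMetricNeZero E e) (k : ℕ) :
    IsSubmanifoldOfDim (jetImage E a k) (prolongationDim n k) := by
  induction k with
  | zero =>
    intro p hp
    obtain ⟨U, F, h, hpU⟩ := exists_isEquation_of_mem_jetImage hg hp
    exact exists_hypersurface_chart h.isOpen h.smooth h.mem_iff hpU (h.fderiv_ne_zero hpU)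
  | succ k ih =>
    intro q hq
    have hp := jetProj_mem_jetImage hq
    obtain ⟨F, U, T, hpU, hS⟩ := exists_affineTriv_of_mem_jetImage hg hp
    exact T.exists_submanifold_chart hS ih hpU hp

theorem surjOn_basePoint (hg : ∀ e ∈ E, ConformalMetricNeZero E e) (k : ℕ) :
    SurjOn (basePoint (X := prolongation C (k + 1))) (prolongedEquation E (k + 1))
      (prolongedEquation E k) := by
  intro x hx
  obtain ⟨a, ha⟩ := exists_mem_source hg k hx
  have hp : (prolongation C (k + 1)).coord a x ∈ jetImage E a k :=
    ChartSystem.coord_mem_image ha hx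
  obtain ⟨F, U, T, hpU, hS⟩ := exists_affineTriv_of_mem_jetImage hg hp
  have hproj := T.jetProj_sol ((prolongation C (k + 1)).coord a x) 0
  obtain ⟨y, ⟨hy, hya⟩, hyq⟩ := (hS (T.sol _ 0) (hproj.symm ▸ hpU)).2
    ⟨hproj.symm ▸ hp, T.H_sol hpU 0⟩
  refine ⟨y, hy, (isContactSystem_prolongation C (k + 1)).injOn a
    (basePoint_mem_source (X := prolongation C (k + 1)) hya) ha ?_⟩
  exact (jetProj_coord (X := prolongation C (k + 1)) hya).symm.trans
    ((congrArg (jetProj n (k + 2)) hyq).trans hproj)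

/-- The complementary coordinates `T.B` are the fibre coordinates and `T.sol` inverts them. The
typical fibre is a Euclidean space whose dimension depends only on `n` and `k`, since the symbol map
is onto everywhere. -/
theorem isSmoothFibreBundle_prolongedEquation (hg : ∀ e ∈ E, ConformalMetricNeZero E e) (k : ℕ) :
    IsSmoothFibreBundle (X := prolongation C (k + 1)) (prolongedEquation E k)
      (prolongedEquation E (k + 1)) := by
  refine ⟨fun y hy => hy.1, surjOn_basePoint hg k, fibreDim n k,
    EuclideanSpace ℝ (Fin (fibreDim n k)), inferInstance, inferInstance, inferInstance,
    inferInstance, fun a b hb hba => ?_⟩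
  have hp : (prolongation C (k + 1)).coord a b ∈ jetImage E a k :=
    ChartSystem.coord_mem_image hba hb
  obtain ⟨F, U, T, hpU, hS⟩ := exists_affineTriv_of_mem_jetImage hg hp
  refine ⟨U, fun q => T.B (topPart n (k + 2) q), fun r => T.sol r.1 r.2, T.isOpen, hpU,
    fun y _ hya _ => (mem_source_prolong_iff (Nat.le_add_left 1 k)).2 hya, ?_, ?_, ?_, ?_⟩
  · exact (T.B.comp (topPart n (k + 2))).contDiff.contMDiff.contMDiffOn
  · rw [← modelWithCornersSelf_prod, chartedSpaceSelf_prod, contMDiffOn_iff_contDiffOn]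
    exact T.contDiffOn_sol.mono (prod_mono inter_subset_right subset_rfl)
  · rintro q ⟨hq, hqU⟩ f
    have hproj := T.jetProj_sol q f
    exact ⟨(hS (T.sol q f) (hproj.symm ▸ hqU)).2 ⟨hproj.symm ▸ hq, T.H_sol hqU f⟩, hproj,
      T.B_sol hqU f⟩
  · intro q hq hqU
    exact ⟨jetProj_mem_jetImage hq, T.sol_eq hqU ((hS q hqU).1 hq).2⟩

theorem formallyIntegrable_of_conformalMetricNeZero
    (hg : ∀ e ∈ E, ConformalMetricNeZero E e) : FormallyIntegrable E :=
  ⟨fun k => ⟨prolongationDim n k, fun _ => isSubmanifoldOfDim_jetImage hg k⟩,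
    isSmoothFibreBundle_prolongedEquation hg⟩

end Integrability

end ContactPDE

end

theorem mainTheorem12 (n : ℕ) (M : Type*) [TopologicalSpace M]
    [ChartedSpace (EuclideanSpace ℝ (Fin (2 * n + 1))) M] [IsManifold (𝓡 (2 * n + 1)) ∞ M]
    (C : ContactPDE.ContactStructure n M)
    (E : Set (ContactPDE.prolongation C 1).carrier)
    (hE : ContactPDE.IsSecondOrderPDE E)
    (hg : ∀ e ∈ E, ContactPDE.ConformalMetricNeZero E e) :
    ContactPDE.FormallyIntegrable E := by
  exact ContactPDE.formallyIntegrable_of_conformalMetricNeZero hg
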